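/- Let $(M_1,g_1,J_1)$ be a Kähler manifold and $(M_2,g_2,J_2)$ an almost Hermitian manifold (smooth, finite-dimensional, without boundary): $g_i$ is a smooth Riemannian metric and $J_i$ a smooth $(1,1)$-tensor field with $J_i^2=-I$ and $g_i(J_iX,J_iY)=g_i(X,Y)$, and moreover $(\nabla^1_X J_1)Y=0$ for all $X,Y$, where $\nabla^i$ is the Levi-Civita connection of $g_i$. Let $F:M_1\to M_2$ be a holomorphic Riemannian map, i.e. a smooth map such that $g_2(F_*X,F_*Y)=g_1(X,Y)$ for all $X,Y\in(\ker F_{*p})^\perp$, $p\in M_1$, and $J_2F_*=F_*J_1$. Denote by $\nabla^F$ the pullback of $\nabla^2$ to $F^{-1}TM_2$ and by $(\nabla F_*)(X,Y)=\nabla^F_X F_*Y-F_*(\nabla^1_XY)$ the second fundamental form of $F$. Then $F$ is harmonic, i.e. its tension field $\tau(F)=\operatorname{trace}(\nabla F_*)$ vanishes identically, if and only if the distribution $F_*((\ker F_*)^\perp)=\operatorname{range}F_*$ along $F$ is minimal, i.e. its mean curvature vector field $$H=\sum_a\bigl(\nabla^F_{e_a}F_*e_a\bigr)^{\perp}$$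 vanishes identically. Here $(e_a)$ is an orthonormal basis of $(\ker F_{*p})^\perp$ at the point $p$ considered, each $F_*e_a$ is extended to a smooth local section of $\operatorname{range}F_*$ (the value of $H$ does not depend on these choices), and $^{\perp}$ denotes the component orthogonal to $\operatorname{range}F_{*p}$ in $T_{F(p)}M_2$. -/

import Mathlib

open Bundle Filter
open scoped Manifold ContDiff Topology

noncomputable section

/-! Throughout, a manifold `M` is a smooth manifold without boundary modelled on a finite
dimensional real vector space `E`, and a Riemannian metric on it is given by Mathlib's classes
`RiemannianBundle` and `IsContMDiffRiemannianBundle` on the tangent bundle. -/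

instance tangentSpace_finiteDimensional
    {E : Type*} [NormedAddCommGroup E] [NormedSpace ℝ E] [FiniteDimensional ℝ E]
    {M : Type*} [TopologicalSpace M] [ChartedSpace E M] (p : M) :
    FiniteDimensional ℝ (TangentSpace 𝓘(ℝ, E) p) :=
  inferInstanceAs (FiniteDimensional ℝ E)

/-- The differential `F_*` at `p`. -/
def differential (E₁ : Type*) [NormedAddCommGroup E₁] [NormedSpace ℝ E₁]
    (E₂ : Type*) [NormedAddCommGroup E₂] [NormedSpace ℝ E₂]
    {M₁ : Type*} [TopologicalSpace M₁] [ChartedSpace E₁ M₁]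
    {M₂ : Type*} [TopologicalSpace M₂] [ChartedSpace E₂ M₂] (F : M₁ → M₂) (p : M₁) :
    TangentSpace 𝓘(ℝ, E₁) p →L[ℝ] TangentSpace 𝓘(ℝ, E₂) (F p) :=
  mfderiv 𝓘(ℝ, E₁) 𝓘(ℝ, E₂) F p

section Connection

variable {E : Type*} [NormedAddCommGroup E] [NormedSpace ℝ E] [FiniteDimensional ℝ E]
  {M : Type*} [TopologicalSpace M] [ChartedSpace E M] [IsManifold 𝓘(ℝ, E) ∞ M]

/-- The coordinate vector field of the preferred chart at `p` whose value at `p` is `v`: near `p`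
it has constant components in that chart. -/
def coordField {p : M} (v : TangentSpace 𝓘(ℝ, E) p) (q : M) : TangentSpace 𝓘(ℝ, E) q :=
  FiberBundle.extend E v q

variable [RiemannianBundle (fun p : M ↦ TangentSpace 𝓘(ℝ, E) p)]

/-- `∂_w (g(U, V))` at `p`, where `U`, `V` are the coordinate fields of the chart at `p` that extend
`u`, `v`: a first partial derivative of the components of the metric. -/
def metricDeriv (p : M) (w u v : TangentSpace 𝓘(ℝ, E) p) : ℝ :=
  mvfderiv 𝓘(ℝ, E) (fun q : M ↦ inner ℝ (coordField u q) (coordField v q)) p w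

/-- The Christoffel symbols of the Levi-Civita connection in the preferred chart at `p`, evaluated
at `p`: `Γ(u, v)` is the tangent vector with
`g(Γ(u, v), w) = ½ (∂_u g(V, W) + ∂_v g(U, W) - ∂_w g(U, V))` for all `w`. -/
def christoffel (p : M) (u v : TangentSpace 𝓘(ℝ, E) p) : TangentSpace 𝓘(ℝ, E) p :=
  ∑ i, ((1 / 2 : ℝ) * (metricDeriv p u v (stdOrthonormalBasis ℝ (TangentSpace 𝓘(ℝ, E) p) i)
      + metricDeriv p v u (stdOrthonormalBasis ℝ (TangentSpace 𝓘(ℝ, E) p) i)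
      - metricDeriv p (stdOrthonormalBasis ℝ (TangentSpace 𝓘(ℝ, E) p) i) u v)) •
    stdOrthonormalBasis ℝ (TangentSpace 𝓘(ℝ, E) p) i

/-- The Levi-Civita covariant derivative `(∇_u Y)(p)` of a vector field `Y`:
in the preferred chart at `p`, `∇_u Y = ∂_u Y + Γ(u, Y)`. -/
def leviCivita (Y : Π q : M, TangentSpace 𝓘(ℝ, E) q) (p : M) (u : TangentSpace 𝓘(ℝ, E) p) :
    TangentSpace 𝓘(ℝ, E) p :=
  (trivializationAt E (TangentSpace 𝓘(ℝ, E)) p).symmL ℝ p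
      (mvfderiv 𝓘(ℝ, E)
        (fun q : M ↦ (trivializationAt E (TangentSpace 𝓘(ℝ, E)) p ⟨q, Y q⟩).2) p u)
    + christoffel p u (Y p)

end Connection

section Maps

variable (E₁ : Type*) [NormedAddCommGroup E₁] [NormedSpace ℝ E₁] [FiniteDimensional ℝ E₁]
  (E₂ : Type*) [NormedAddCommGroup E₂] [NormedSpace ℝ E₂] [FiniteDimensional ℝ E₂]
  {M₁ : Type*} [TopologicalSpace M₁] [ChartedSpace E₁ M₁] [IsManifold 𝓘(ℝ, E₁) ∞ M₁]
  {M₂ : Type*} [TopologicalSpace M₂] [ChartedSpace E₂ M₂] [IsManifold 𝓘(ℝ, E₂) ∞ M₂]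
  [RiemannianBundle (fun p : M₁ ↦ TangentSpace 𝓘(ℝ, E₁) p)]
  [RiemannianBundle (fun p : M₂ ↦ TangentSpace 𝓘(ℝ, E₂) p)]

variable {E₁ E₂} in
/-- The pullback `∇^F` of the Levi-Civita connection of `M₂` along `F : M₁ → M₂`: the covariant
derivative `(∇^F_u V)(p)` of a section `V` of `F⁻¹TM₂`. In the preferred chart of `M₂` at `F p`,
`∇^F_u V = ∂_u V + Γ(F_* u, V)`. -/
def pullbackConnection (F : M₁ → M₂) (V : Π q : M₁, TangentSpace 𝓘(ℝ, E₂) (F q)) (p : M₁)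
    (u : TangentSpace 𝓘(ℝ, E₁) p) : TangentSpace 𝓘(ℝ, E₂) (F p) :=
  (trivializationAt E₂ (TangentSpace 𝓘(ℝ, E₂)) (F p)).symmL ℝ (F p)
      (mvfderiv 𝓘(ℝ, E₁)
        (fun q : M₁ ↦ (trivializationAt E₂ (TangentSpace 𝓘(ℝ, E₂)) (F p) ⟨F q, V q⟩).2) p u)
    + christoffel (F p) (differential E₁ E₂ F p u) (V p)

/-- The second fundamental form of `F`, `(∇F_*)(u, v) = ∇^F_u (F_* Y) - F_* (∇_u Y)` at `p`, where
`Y` is the coordinate field of the chart at `p` with `Y p = v`. The right-hand side depends only on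
`Y p`, so this particular extension of `v` is immaterial. -/
def secondFundamentalForm (F : M₁ → M₂) (p : M₁) (u v : TangentSpace 𝓘(ℝ, E₁) p) :
    TangentSpace 𝓘(ℝ, E₂) (F p) :=
  pullbackConnection F (fun q ↦ differential E₁ E₂ F q (coordField v q)) p u
    - differential E₁ E₂ F p (leviCivita (fun q ↦ coordField v q) p u)

/-- The tension field `τ(F) = trace ∇F_*`, a section of `F⁻¹TM₂`. -/
def tensionField (F : M₁ → M₂) (p : M₁) : TangentSpace 𝓘(ℝ, E₂) (F p) :=
  ∑ i, secondFundamentalForm E₁ E₂ F p (stdOrthonormalBasis ℝ (TangentSpace 𝓘(ℝ, E₁) p) i)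
    (stdOrthonormalBasis ℝ (TangentSpace 𝓘(ℝ, E₁) p) i)

/-- `F` is harmonic if its tension field vanishes. -/
def IsHarmonicMap (F : M₁ → M₂) : Prop :=
  ∀ p : M₁, tensionField E₁ E₂ F p = 0

/-- The horizontal space `(ker F_*)^⊥` at `p`. -/
def horizontalSpace (F : M₁ → M₂) (p : M₁) : Submodule ℝ (TangentSpace 𝓘(ℝ, E₁) p) :=
  (LinearMap.ker (differential E₁ E₂ F p).toLinearMap)ᗮ

/-- The distribution `F_*((ker F_*)^⊥) = range F_*` along `F`. -/
def rangeDistribution (F : M₁ → M₂) (p : M₁) : Submodule ℝ (TangentSpace 𝓘(ℝ, E₂) (F p)) :=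
  (horizontalSpace E₁ E₂ F p).map (differential E₁ E₂ F p).toLinearMap

/-- The distribution `F_*((ker F_*)^⊥)` is minimal: its mean curvature vector field
`∑ₐ (∇^F_{eₐ} F_* eₐ)^⊥` vanishes. Here `eₐ` is any orthonormal basis of the horizontal space at
`p`, each `F_* eₐ` is extended by an arbitrary section `V a` of the distribution that is smooth near
`p`, and `⊥` is the component orthogonal to the distribution. -/
def IsMinimalRange (F : M₁ → M₂) : Prop :=
  ∀ (p : M₁) (k : ℕ) (e : Fin k → TangentSpace 𝓘(ℝ, E₁) p)
    (V : Fin k → Π q : M₁, TangentSpace 𝓘(ℝ, E₂) (F q)),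
    Orthonormal ℝ e → Submodule.span ℝ (Set.range e) = horizontalSpace E₁ E₂ F p →
    (∀ a q, V a q ∈ rangeDistribution E₁ E₂ F q) →
    (∀ a, ContMDiffAt 𝓘(ℝ, E₁) (𝓘(ℝ, E₂).prod 𝓘(ℝ, E₂)) ∞
      (fun q ↦ (⟨F q, V a q⟩ : TangentBundle 𝓘(ℝ, E₂) M₂)) p) →
    (∀ a, V a p = differential E₁ E₂ F p (e a)) →
    ∑ a, ((rangeDistribution E₁ E₂ F p)ᗮ).starProjection (pullbackConnection F (V a) p (e a)) = 0

/-- A Riemannian map: a smooth map whose differential is isometric on the horizontal spaces. -/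
structure IsRiemannianMap (F : M₁ → M₂) : Prop where
  smooth : ContMDiff 𝓘(ℝ, E₁) 𝓘(ℝ, E₂) ∞ F
  isometric : ∀ (p : M₁), ∀ X ∈ horizontalSpace E₁ E₂ F p, ∀ Y ∈ horizontalSpace E₁ E₂ F p,
    inner ℝ (differential E₁ E₂ F p X) (differential E₁ E₂ F p Y) = inner ℝ X Y

variable {E₁ E₂} in
/-- A holomorphic Riemannian map: a Riemannian map with `J₂ F_* = F_* J₁`. -/
structure IsHolomorphicRiemannianMap
    (J₁ : Π p : M₁, TangentSpace 𝓘(ℝ, E₁) p →L[ℝ] TangentSpace 𝓘(ℝ, E₁) p)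
    (J₂ : Π p : M₂, TangentSpace 𝓘(ℝ, E₂) p →L[ℝ] TangentSpace 𝓘(ℝ, E₂) p)
    (F : M₁ → M₂) : Prop extends IsRiemannianMap E₁ E₂ F where
  holomorphic : ∀ (p : M₁) (X : TangentSpace 𝓘(ℝ, E₁) p),
    J₂ (F p) (differential E₁ E₂ F p X) = differential E₁ E₂ F p (J₁ p X)

end Maps

section Hermitian

variable {E : Type*} [NormedAddCommGroup E] [NormedSpace ℝ E] [FiniteDimensional ℝ E]
  {M : Type*} [TopologicalSpace M] [ChartedSpace E M] [IsManifold 𝓘(ℝ, E) ∞ M]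
  [RiemannianBundle (fun p : M ↦ TangentSpace 𝓘(ℝ, E) p)]

/-- `J` is an almost Hermitian structure: a smooth tensor field of type (1, 1) with `J² = -I` and
`g(JX, JY) = g(X, Y)`. -/
structure IsAlmostHermitian
    (J : Π p : M, TangentSpace 𝓘(ℝ, E) p →L[ℝ] TangentSpace 𝓘(ℝ, E) p) : Prop where
  smooth : ContMDiff 𝓘(ℝ, E) (𝓘(ℝ, E).prod 𝓘(ℝ, E →L[ℝ] E)) ∞
    (fun p : M ↦ (⟨p, J p⟩ : TotalSpace (E →L[ℝ] E)
      fun p : M ↦ TangentSpace 𝓘(ℝ, E) p →L[ℝ] TangentSpace 𝓘(ℝ, E) p))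
  sq : ∀ (p : M) (X : TangentSpace 𝓘(ℝ, E) p), J p (J p X) = -X
  isometric : ∀ (p : M) (X Y : TangentSpace 𝓘(ℝ, E) p),
    inner ℝ (J p X) (J p Y) = inner ℝ X Y

/-- A Kähler structure: an almost Hermitian structure with `(∇_X J) Y = ∇_X (JY) - J ∇_X Y = 0`. -/
structure IsKaehler
    (J : Π p : M, TangentSpace 𝓘(ℝ, E) p →L[ℝ] TangentSpace 𝓘(ℝ, E) p) : Prop
    extends IsAlmostHermitian J where
  parallel : ∀ (p : M) (X : TangentSpace 𝓘(ℝ, E) p) (Y : Π q : M, TangentSpace 𝓘(ℝ, E) q),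
    ContMDiffAt 𝓘(ℝ, E) (𝓘(ℝ, E).prod 𝓘(ℝ, E)) ∞
      (fun q ↦ (⟨q, Y q⟩ : TangentBundle 𝓘(ℝ, E) M)) p →
    leviCivita (fun q ↦ J q (Y q)) p X = J p (leviCivita Y p X)

end Hermitian

end

/-!
A Riemannian map `F` out of a Kähler manifold which intertwines the almost complex structures has
tension field `τ(F) = trace B`, where `B = ∇F_*` is the second fundamental form. Split the trace
into a vertical and a horizontal part, along `ker F_*` and `(ker F_*)^⊥`.

* The vertical part is zero. If `u` is vertical, differentiate `F_* J₁ = J₂ F_*` in the direction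
  `u`: the derivative of `J₂` is taken along `F_* u = 0`, and `∇J₁ = 0`, so
  `B(u, J₁ y) = J₂ B(u, y)` for every `y` (`secondFundamentalForm_vertical_apply`). As `B` is
  symmetric, `B(J₁ u, J₁ u) = -B(u, u)`, whereas `J₁` carries orthonormal bases of `ker F_*` to
  orthonormal bases of `ker F_*`. Nothing is required of `∇J₂`.
* On horizontal vectors `B` is orthogonal to `range F_*`
  (`IsRiemannianMap.inner_secondFundamentalForm_differential`). For a vector field `X`, the function
  `|X|² - |F_* X|²` is nonnegative, and zero where `X` is horizontal, hence critical there. Since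
  both connections are metric, this gives `⟨B(z, x), F_* x⟩ = 0` for `x` horizontal, so that
  `⟨B(z, x), F_* y⟩` is skew in the horizontal vectors `x`, `y`; being symmetric in `z`, `x`, it
  vanishes.
* The horizontal part is the mean curvature vector of the range distribution
  (`IsRiemannianMap.starProjection_pullbackConnection`): a section `W` of the distribution that
  vanishes at `p` has its derivative at `p` in `range F_*`. Indeed `W = F_* X` with `X` horizontal
  and `|X| = |W|`, so `W` differs by `o(|q - p|)` from a section with values in the range at `p`.

So `τ(F)` equals the mean curvature vector at each point. No smooth extension of vertical or
horizontal vectors to vertical or horizontal fields is used, hence no constant rank argument.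
All computations are made in the preferred charts at `p` and at `F p`.
-/

/-! ### Components of tangent vectors in the preferred charts -/

section Coordinates

variable {E : Type*} [NormedAddCommGroup E] [NormedSpace ℝ E]
  {M : Type*} [TopologicalSpace M] [ChartedSpace E M]

lemma eventually_mem_chart_source (E : Type*) [TopologicalSpace E]
    {M : Type*} [TopologicalSpace M] [ChartedSpace E M] (p : M) :
    ∀ᶠ q in 𝓝 p, q ∈ (chartAt E p).source :=
  (chartAt E p).open_source.mem_nhds (mem_chart_source E p)

lemma Filter.EventuallyEq.mvfderiv_eq {G : Type*} [NormedAddCommGroup G] [NormedSpace ℝ G]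
    {f g : M → G} {p : M} (h : f =ᶠ[𝓝 p] g) :
    mvfderiv 𝓘(ℝ, E) f p = mvfderiv 𝓘(ℝ, E) g p := by
  ext u
  have := h.mfderiv_eq (I := 𝓘(ℝ, E)) (I' := 𝓘(ℝ, G))
  simp only [mvfderiv]
  simp [this]
  rfl

lemma MDifferentiableAt.differentiableAt_comp_extChartAt_symm {G : Type*} [NormedAddCommGroup G]
    [NormedSpace ℝ G] {f : M → G} {p : M} (hf : MDifferentiableAt 𝓘(ℝ, E) 𝓘(ℝ, G) f p) :
    DifferentiableAt ℝ (f ∘ (extChartAt 𝓘(ℝ, E) p).symm) (extChartAt 𝓘(ℝ, E) p p) := by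
  have := (mdifferentiableAt_iff _ _).1 hf |>.2
  rwa [modelWithCornersSelf_coe, Set.range_id, differentiableWithinAt_univ] at this

variable [IsManifold 𝓘(ℝ, E) ∞ M]

/-- The components of a tangent vector at `q` in the preferred chart at `p`; the zero map if `q` is
outside the domain of this chart. -/
noncomputable def coords (p q : M) : TangentSpace 𝓘(ℝ, E) q →L[ℝ] E :=
  (trivializationAt E (TangentSpace 𝓘(ℝ, E)) p).continuousLinearMapAt ℝ q

/-- The tangent vector at `q` with given components in the preferred chart at `p`; the zero map if
`q` is outside the domain of this chart. -/
noncomputable def ofCoords (p q : M) : E →L[ℝ] TangentSpace 𝓘(ℝ, E) q :=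
  (trivializationAt E (TangentSpace 𝓘(ℝ, E)) p).symmL ℝ q

lemma mem_trivializationAt_baseSet {p q : M} (hq : q ∈ (chartAt E p).source) :
    q ∈ (trivializationAt E (TangentSpace 𝓘(ℝ, E)) p).baseSet := by
  simpa using hq

lemma trivializationAt_snd {p q : M} (hq : q ∈ (chartAt E p).source)
    (w : TangentSpace 𝓘(ℝ, E) q) :
    (trivializationAt E (TangentSpace 𝓘(ℝ, E)) p ⟨q, w⟩).2 = coords p q w := by
  rw [coords, Trivialization.continuousLinearMapAt_apply,
    Trivialization.linearMapAt_apply, if_pos (mem_trivializationAt_baseSet hq)]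

lemma coords_ofCoords {p q : M} (hq : q ∈ (chartAt E p).source) (x : E) :
    coords p q (ofCoords p q x) = x :=
  Trivialization.continuousLinearMapAt_symmL _ (mem_trivializationAt_baseSet hq) x

lemma ofCoords_coords {p q : M} (hq : q ∈ (chartAt E p).source) (w : TangentSpace 𝓘(ℝ, E) q) :
    ofCoords p q (coords p q w) = w :=
  Trivialization.symmL_continuousLinearMapAt _ (mem_trivializationAt_baseSet hq) w

/-- At the base point of the preferred chart, the components of a tangent vector are the vector
itself, under the identification of the tangent space with the model space. -/
lemma coords_self (p : M) (v : TangentSpace 𝓘(ℝ, E) p) : coords p p v = (v : E) := by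
  rw [coords, TangentBundle.continuousLinearMapAt_trivializationAt (mem_chart_source E p),
    mfderiv_extChartAt_self]
  rfl

/-- The derivative of a vector-valued function is its Fréchet derivative in the preferred chart. -/
lemma mvfderiv_eq_fderiv {G : Type*} [NormedAddCommGroup G] [NormedSpace ℝ G] {f : M → G} {p : M}
    (hf : MDifferentiableAt 𝓘(ℝ, E) 𝓘(ℝ, G) f p) (u : TangentSpace 𝓘(ℝ, E) p) :
    mvfderiv 𝓘(ℝ, E) f p u =
      fderiv ℝ (f ∘ (extChartAt 𝓘(ℝ, E) p).symm) (extChartAt 𝓘(ℝ, E) p p) (coords p p u) := by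
  rw [hf.mvfderiv, coords_self]
  simp [writtenInExtChartAt, Function.comp_def]
  rfl

lemma mvfderiv_clm_apply {G G' : Type*} [NormedAddCommGroup G] [NormedSpace ℝ G]
    [NormedAddCommGroup G'] [NormedSpace ℝ G'] {g : M → G →L[ℝ] G'} {f : M → G} {p : M}
    (hg : MDifferentiableAt 𝓘(ℝ, E) 𝓘(ℝ, G →L[ℝ] G') g p)
    (hf : MDifferentiableAt 𝓘(ℝ, E) 𝓘(ℝ, G) f p) (u : TangentSpace 𝓘(ℝ, E) p) :
    mvfderiv 𝓘(ℝ, E) (fun q ↦ g q (f q)) p u =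
      g p (mvfderiv 𝓘(ℝ, E) f p u) + mvfderiv 𝓘(ℝ, E) g p u (f p) := by
  rw [mvfderiv_eq_fderiv (hg.clm_apply hf), mvfderiv_eq_fderiv hg, mvfderiv_eq_fderiv hf]
  have := (hg.differentiableAt_comp_extChartAt_symm.hasFDerivAt.clm_apply
    hf.differentiableAt_comp_extChartAt_symm.hasFDerivAt).fderiv
  simp only [Function.comp_def] at this ⊢
  rw [this]
  simp

lemma exists_linearMap_mvfderiv (G : M → E →L[ℝ] E →L[ℝ] ℝ) (p : M) :
    ∃ D : TangentSpace 𝓘(ℝ, E) p →ₗ[ℝ] TangentSpace 𝓘(ℝ, E) p →ₗ[ℝ]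
      TangentSpace 𝓘(ℝ, E) p →ₗ[ℝ] ℝ,
      ∀ w u v, D w u v = mvfderiv 𝓘(ℝ, E) G p w (coords p p u) (coords p p v) :=
  ⟨{ toFun := fun w ↦ LinearMap.mk₂ ℝ
      (fun u v ↦ mvfderiv 𝓘(ℝ, E) G p w (coords p p u) (coords p p v))
      (by simp) (by simp) (by simp) (by simp)
     map_add' := fun w w' ↦ LinearMap.ext₂ fun u v ↦
      congr($((mvfderiv 𝓘(ℝ, E) G p).map_add w w') _ _)
     map_smul' := fun c w ↦ LinearMap.ext₂ fun u v ↦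
      congr($((mvfderiv 𝓘(ℝ, E) G p).map_smul c w) _ _) },
   fun w u v ↦ rfl⟩

lemma coordField_eq [FiniteDimensional ℝ E] {p q : M} (v : TangentSpace 𝓘(ℝ, E) p)
    (hq : q ∈ (chartAt E p).source) : coordField v q = ofCoords p q (coords p p v) := by
  rw [← trivializationAt_snd (mem_chart_source E p), ofCoords,
    Trivialization.symmL_apply _ (mem_trivializationAt_baseSet hq)]
  rfl

lemma coordField_self [FiniteDimensional ℝ E] {p : M} (v : TangentSpace 𝓘(ℝ, E) p) :
    coordField v p = v :=
  FiberBundle.extend_apply_self _ v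

lemma contMDiffAt_coordField [FiniteDimensional ℝ E] {p : M} (v : TangentSpace 𝓘(ℝ, E) p) :
    ContMDiffAt 𝓘(ℝ, E) (𝓘(ℝ, E).prod 𝓘(ℝ, E)) ∞
      (fun q ↦ (⟨q, coordField v q⟩ : TangentBundle 𝓘(ℝ, E) M)) p := by
  refine contMDiffAt_totalSpace.2 ⟨contMDiffAt_id, ?_⟩
  refine (contMDiffAt_const (c := coords p p v)).congr_of_eventuallyEq ?_
  filter_upwards [eventually_mem_chart_source E p] with q hq
  rw [trivializationAt_snd hq, coordField_eq v hq, coords_ofCoords hq]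

variable [RiemannianBundle (fun p : M ↦ TangentSpace 𝓘(ℝ, E) p)]
  [IsContMDiffRiemannianBundle 𝓘(ℝ, E) ∞ E (fun p : M ↦ TangentSpace 𝓘(ℝ, E) p)]

instance isContinuousRiemannianBundle_tangentSpace :
    IsContinuousRiemannianBundle E (fun p : M ↦ TangentSpace 𝓘(ℝ, E) p) := by
  obtain ⟨g, hg, hi⟩ := IsContMDiffRiemannianBundle.exists_contMDiff (IB := 𝓘(ℝ, E)) (n := ∞)
    (F := E) (E := fun p : M ↦ TangentSpace 𝓘(ℝ, E) p)
  exact ⟨g, hg.continuous, hi⟩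

/-- The components of the metric in the preferred chart at `p` are differentiable. -/
lemma exists_metric_coords (p : M) : ∃ G : M → E →L[ℝ] E →L[ℝ] ℝ,
    MDifferentiableAt 𝓘(ℝ, E) 𝓘(ℝ, E →L[ℝ] E →L[ℝ] ℝ) G p ∧
    ∀ q ∈ (chartAt E p).source, ∀ a b, G q a b = inner ℝ (ofCoords p q a) (ofCoords p q b) := by
  obtain ⟨g, hg, hi⟩ := IsContMDiffRiemannianBundle.exists_contMDiff (IB := 𝓘(ℝ, E)) (n := ∞)
    (F := E) (E := fun p : M ↦ TangentSpace 𝓘(ℝ, E) p)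
  refine ⟨fun q ↦ ContinuousLinearMap.inCoordinates E (TangentSpace 𝓘(ℝ, E)) (E →L[ℝ] ℝ)
    (fun q : M ↦ TangentSpace 𝓘(ℝ, E) q →L[ℝ] ℝ) p q p q (g q), ?_, fun q hq a b ↦ ?_⟩
  · have := hg.contMDiffAt (x := p)
    rw [contMDiffAt_hom_bundle] at this
    exact this.2.mdifferentiableAt (by simp)
  · rw [hi, inCoordinates_apply_eq₂ (mem_trivializationAt_baseSet hq)
      (mem_trivializationAt_baseSet hq) (Set.mem_univ _)]
    simp [ofCoords, Trivialization.symmL_apply _ (mem_trivializationAt_baseSet hq)]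

end Coordinates

/-! ### Christoffel symbols and compatibility with the metric -/

section Christoffel

variable {E : Type*} [NormedAddCommGroup E] [NormedSpace ℝ E] [FiniteDimensional ℝ E]
  {M : Type*} [TopologicalSpace M] [ChartedSpace E M] [IsManifold 𝓘(ℝ, E) ∞ M]
  [RiemannianBundle (fun p : M ↦ TangentSpace 𝓘(ℝ, E) p)]

omit [FiniteDimensional ℝ E] in
lemma metricDeriv_comm (p : M) (w u v : TangentSpace 𝓘(ℝ, E) p) :
    metricDeriv p w u v = metricDeriv p w v u := by
  simp only [metricDeriv, real_inner_comm]

lemma inner_coordField_eventuallyEq {p : M} {G : M → E →L[ℝ] E →L[ℝ] ℝ}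
    (hG : ∀ q ∈ (chartAt E p).source, ∀ a b, G q a b = inner ℝ (ofCoords p q a) (ofCoords p q b))
    (u v : TangentSpace 𝓘(ℝ, E) p) :
    (fun q : M ↦ inner ℝ (coordField u q) (coordField v q)) =ᶠ[𝓝 p]
      fun q ↦ G q (coords p p u) (coords p p v) := by
  filter_upwards [eventually_mem_chart_source E p] with q hq
  rw [hG q hq, coordField_eq u hq, coordField_eq v hq]

lemma metricDeriv_eq {p : M} {G : M → E →L[ℝ] E →L[ℝ] ℝ}
    (hd : MDifferentiableAt 𝓘(ℝ, E) 𝓘(ℝ, E →L[ℝ] E →L[ℝ] ℝ) G p)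
    (hG : ∀ q ∈ (chartAt E p).source, ∀ a b, G q a b = inner ℝ (ofCoords p q a) (ofCoords p q b))
    (w u v : TangentSpace 𝓘(ℝ, E) p) :
    metricDeriv p w u v = mvfderiv 𝓘(ℝ, E) G p w (coords p p u) (coords p p v) := by
  have h1 := inner_coordField_eventuallyEq hG u v
  have h2 := hd.clm_apply (mdifferentiableAt_const (c := coords p p u))
  rw [metricDeriv, h1.mvfderiv_eq (E := E), mvfderiv_clm_apply h2 mdifferentiableAt_const,
    mvfderiv_clm_apply hd mdifferentiableAt_const, mvfderiv_const, mvfderiv_const]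
  simp

variable [IsContMDiffRiemannianBundle 𝓘(ℝ, E) ∞ E (fun p : M ↦ TangentSpace 𝓘(ℝ, E) p)]

lemma mdifferentiableAt_inner_coordField {p : M} (u v : TangentSpace 𝓘(ℝ, E) p) :
    MDifferentiableAt 𝓘(ℝ, E) 𝓘(ℝ) (fun q : M ↦ inner ℝ (coordField u q) (coordField v q)) p := by
  obtain ⟨G, hd, hG⟩ := exists_metric_coords (E := E) p
  exact ((hd.clm_apply mdifferentiableAt_const).clm_apply
    mdifferentiableAt_const).congr_of_eventuallyEq (inner_coordField_eventuallyEq hG u v)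

/-- At each point, the first derivatives of the metric form a trilinear form. -/
lemma exists_metricDeriv_eq (p : M) :
    ∃ D : TangentSpace 𝓘(ℝ, E) p →ₗ[ℝ] TangentSpace 𝓘(ℝ, E) p →ₗ[ℝ]
      TangentSpace 𝓘(ℝ, E) p →ₗ[ℝ] ℝ, ∀ w u v, metricDeriv p w u v = D w u v := by
  obtain ⟨G, hd, hG⟩ := exists_metric_coords (E := E) p
  obtain ⟨D, hD⟩ := exists_linearMap_mvfderiv G p
  exact ⟨D, fun w u v ↦ (metricDeriv_eq hd hG w u v).trans (hD w u v).symm⟩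

/-- The Koszul formula for coordinate fields. -/
lemma inner_christoffel (p : M) (u v w : TangentSpace 𝓘(ℝ, E) p) :
    inner ℝ (christoffel p u v) w =
      1 / 2 * (metricDeriv p u v w + metricDeriv p v u w - metricDeriv p w u v) := by
  obtain ⟨D, hD⟩ := exists_metricDeriv_eq (E := E) p
  set b := stdOrthonormalBasis ℝ (TangentSpace 𝓘(ℝ, E) p)
  have hw := b.sum_repr' w
  conv_rhs => rw [← hw]
  simp only [christoffel, hD, map_sum, map_smul, sum_inner, inner_smul_left,
    LinearMap.coe_sum, Finset.sum_apply, LinearMap.smul_apply, ← Finset.sum_add_distrib,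
    ← Finset.sum_sub_distrib, Finset.mul_sum, smul_eq_mul, conj_trivial]
  refine Finset.sum_congr rfl fun i _ ↦ ?_
  ring

lemma christoffel_comm (p : M) (u v : TangentSpace 𝓘(ℝ, E) p) :
    christoffel p u v = christoffel p v u := by
  refine ext_inner_right ℝ fun w ↦ ?_
  rw [inner_christoffel, inner_christoffel, metricDeriv_comm p w u v]
  ring

lemma christoffel_add_right (p : M) (u v v' : TangentSpace 𝓘(ℝ, E) p) :
    christoffel p u (v + v') = christoffel p u v + christoffel p u v' := by
  obtain ⟨D, hD⟩ := exists_metricDeriv_eq (E := E) p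
  refine ext_inner_right ℝ fun w ↦ ?_
  simp only [inner_add_left, inner_christoffel, hD, map_add,
    LinearMap.add_apply]
  ring

lemma christoffel_smul_right (p : M) (c : ℝ) (u v : TangentSpace 𝓘(ℝ, E) p) :
    christoffel p u (c • v) = c • christoffel p u v := by
  obtain ⟨D, hD⟩ := exists_metricDeriv_eq (E := E) p
  refine ext_inner_right ℝ fun w ↦ ?_
  simp only [inner_smul_left, inner_christoffel, hD, map_smul,
    LinearMap.smul_apply, smul_eq_mul, conj_trivial]
  ring

/-- The Levi-Civita connection is compatible with the metric. -/
lemma inner_christoffel_add (p : M) (u v w : TangentSpace 𝓘(ℝ, E) p) :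
    inner ℝ (christoffel p u v) w + inner ℝ v (christoffel p u w) = metricDeriv p u v w := by
  rw [real_inner_comm _ v, inner_christoffel, inner_christoffel, metricDeriv_comm p u w v,
    metricDeriv_comm p w u v, metricDeriv_comm p v u w]
  ring

end Christoffel

/-! ### The Jacobian in charts and the symmetry of its derivative -/

section Jacobian

variable {E₁ : Type*} [NormedAddCommGroup E₁] [NormedSpace ℝ E₁]
  {E₂ : Type*} [NormedAddCommGroup E₂] [NormedSpace ℝ E₂]
  {M₁ : Type*} [TopologicalSpace M₁] [ChartedSpace E₁ M₁] [IsManifold 𝓘(ℝ, E₁) ∞ M₁]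
  {M₂ : Type*} [TopologicalSpace M₂] [ChartedSpace E₂ M₂] [IsManifold 𝓘(ℝ, E₂) ∞ M₂]

/-- The Jacobian of `F` at `q` in the preferred charts at `p` and `F p`. -/
noncomputable def jacobian (F : M₁ → M₂) (p q : M₁) : E₁ →L[ℝ] E₂ :=
  coords (F p) (F q) ∘L differential E₁ E₂ F q ∘L ofCoords p q

lemma jacobian_apply (F : M₁ → M₂) (p q : M₁) (x : E₁) :
    jacobian F p q x = coords (F p) (F q) (differential E₁ E₂ F q (ofCoords p q x)) :=
  rfl

lemma contMDiffAt_jacobian {F : M₁ → M₂} {p : M₁}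
    (hF : ContMDiffAt 𝓘(ℝ, E₁) 𝓘(ℝ, E₂) ∞ F p) :
    ContMDiffAt 𝓘(ℝ, E₁) 𝓘(ℝ, E₁ →L[ℝ] E₂) ∞ (jacobian (E₁ := E₁) (E₂ := E₂) F p) p :=
  hF.mfderiv_const (m := ∞) (by simp)

lemma fderiv_writtenInExtChartAt {F : M₁ → M₂} {p : M₁} {x : E₁}
    (hx : x ∈ (extChartAt 𝓘(ℝ, E₁) p).target)
    (hF : MDifferentiableAt 𝓘(ℝ, E₁) 𝓘(ℝ, E₂) F ((extChartAt 𝓘(ℝ, E₁) p).symm x))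
    (hFx : F ((extChartAt 𝓘(ℝ, E₁) p).symm x) ∈ (chartAt E₂ (F p)).source) :
    fderiv ℝ (writtenInExtChartAt 𝓘(ℝ, E₁) 𝓘(ℝ, E₂) p F) x =
      jacobian F p ((extChartAt 𝓘(ℝ, E₁) p).symm x) := by
  set q := (extChartAt 𝓘(ℝ, E₁) p).symm x with hq
  have hqs : q ∈ (chartAt E₁ p).source := by
    have := (extChartAt 𝓘(ℝ, E₁) p).map_target hx
    rwa [extChartAt_source] at this
  have hxq : extChartAt 𝓘(ℝ, E₁) p q = x := (extChartAt 𝓘(ℝ, E₁) p).right_inv hx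
  have h1 : MDifferentiableAt 𝓘(ℝ, E₁) 𝓘(ℝ, E₁) (extChartAt 𝓘(ℝ, E₁) p).symm x := by
    have := mdifferentiableWithinAt_extChartAt_symm (I := 𝓘(ℝ, E₁)) hx
    rwa [modelWithCornersSelf_coe, Set.range_id, mdifferentiableWithinAt_univ] at this
  have h2 : MDifferentiableAt 𝓘(ℝ, E₂) 𝓘(ℝ, E₂) (extChartAt 𝓘(ℝ, E₂) (F p)) (F q) :=
    mdifferentiableAt_extChartAt hFx
  have h3 := (h2.hasMFDerivAt.comp x (hF.hasMFDerivAt.comp x h1.hasMFDerivAt)).mfderiv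
  rw [mfderiv_eq_fderiv] at h3
  refine h3.trans ?_
  rw [jacobian, coords, ofCoords, TangentBundle.continuousLinearMapAt_trivializationAt hFx,
    TangentBundle.symmL_trivializationAt hqs, hxq]
  simp only [modelWithCornersSelf_coe, Set.range_id, mfderivWithin_univ]
  rfl

/-- The derivative of the Jacobian at `p` is the Hessian of `F` in charts, hence symmetric. -/
lemma mvfderiv_jacobian_comm {F : M₁ → M₂} (hF : ContMDiff 𝓘(ℝ, E₁) 𝓘(ℝ, E₂) ∞ F) (p : M₁)
    (u v : TangentSpace 𝓘(ℝ, E₁) p) :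
    mvfderiv 𝓘(ℝ, E₁) (jacobian (E₁ := E₁) (E₂ := E₂) F p) p u (coords p p v) =
      mvfderiv 𝓘(ℝ, E₁) (jacobian (E₁ := E₁) (E₂ := E₂) F p) p v (coords p p u) := by
  have hd := (contMDiffAt_jacobian (hF p)).mdifferentiableAt (by simp)
  have hev : jacobian (E₁ := E₁) (E₂ := E₂) F p ∘ (extChartAt 𝓘(ℝ, E₁) p).symm
      =ᶠ[𝓝 (extChartAt 𝓘(ℝ, E₁) p p)]
      fderiv ℝ (writtenInExtChartAt 𝓘(ℝ, E₁) 𝓘(ℝ, E₂) p F) := by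
    have h1 : ContinuousAt (F ∘ (extChartAt 𝓘(ℝ, E₁) p).symm) (extChartAt 𝓘(ℝ, E₁) p p) :=
      hF.continuous.continuousAt.comp (continuousAt_extChartAt_symm p)
    have h2 : ∀ᶠ x in 𝓝 (extChartAt 𝓘(ℝ, E₁) p p),
        F ((extChartAt 𝓘(ℝ, E₁) p).symm x) ∈ (chartAt E₂ (F p)).source := by
      refine h1.eventually ?_
      simpa using eventually_mem_chart_source E₂ (F p)
    filter_upwards [h2, extChartAt_target_mem_nhds (I := 𝓘(ℝ, E₁)) p] with x hx hx'
    exact (fderiv_writtenInExtChartAt hx' (hF.mdifferentiable (by simp) _) hx).symm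
  have hs : ContDiffAt ℝ ∞ (writtenInExtChartAt 𝓘(ℝ, E₁) 𝓘(ℝ, E₂) p F)
      (extChartAt 𝓘(ℝ, E₁) p p) := by
    have := (contMDiffAt_iff.1 (hF p)).2
    rwa [modelWithCornersSelf_coe, Set.range_id, contDiffWithinAt_univ] at this
  rw [mvfderiv_eq_fderiv hd, mvfderiv_eq_fderiv hd, hev.fderiv_eq]
  exact hs.isSymmSndFDerivAt (by simpa using ENat.LEInfty.out) _ _

end Jacobian

/-! ### The pullback connection -/

section PullbackConnection

variable {E₁ : Type*} [NormedAddCommGroup E₁] [NormedSpace ℝ E₁]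
  {E₂ : Type*} [NormedAddCommGroup E₂] [NormedSpace ℝ E₂] [FiniteDimensional ℝ E₂]
  {M₁ : Type*} [TopologicalSpace M₁] [ChartedSpace E₁ M₁] [IsManifold 𝓘(ℝ, E₁) ∞ M₁]
  {M₂ : Type*} [TopologicalSpace M₂] [ChartedSpace E₂ M₂] [IsManifold 𝓘(ℝ, E₂) ∞ M₂]
  [RiemannianBundle (fun p : M₂ ↦ TangentSpace 𝓘(ℝ, E₂) p)]

omit [NormedSpace ℝ E₂]
  [FiniteDimensional ℝ E₂] [IsManifold 𝓘(ℝ, E₂) ∞ M₂]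
  [RiemannianBundle (fun p : M₂ ↦ TangentSpace 𝓘(ℝ, E₂) p)] in
lemma eventually_map_mem_chart_source {F : M₁ → M₂} {p : M₁} (hF : ContinuousAt F p) :
    ∀ᶠ q in 𝓝 p, F q ∈ (chartAt E₂ (F p)).source :=
  hF.eventually (eventually_mem_chart_source E₂ (F p))

omit [FiniteDimensional ℝ E₂] in
lemma inner_eventuallyEq_pullback {F : M₁ → M₂} {p : M₁} (hF : ContinuousAt F p)
    {G : M₂ → E₂ →L[ℝ] E₂ →L[ℝ] ℝ}
    (hG : ∀ q ∈ (chartAt E₂ (F p)).source, ∀ a b,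
      G q a b = inner ℝ (ofCoords (F p) q a) (ofCoords (F p) q b))
    (V W : Π q : M₁, TangentSpace 𝓘(ℝ, E₂) (F q)) :
    (fun q ↦ inner ℝ (V q) (W q)) =ᶠ[𝓝 p]
      fun q ↦ (G ∘ F) q (coords (F p) (F q) (V q)) (coords (F p) (F q) (W q)) := by
  filter_upwards [eventually_map_mem_chart_source (E₂ := E₂) hF] with q hq
  simp only [Function.comp_apply]
  rw [hG _ hq, ofCoords_coords hq, ofCoords_coords hq]

omit [IsManifold 𝓘(ℝ, E₁) ∞ M₁] in
lemma pullbackConnection_eq {F : M₁ → M₂} {p : M₁} (hF : ContinuousAt F p)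
    (V : Π q : M₁, TangentSpace 𝓘(ℝ, E₂) (F q)) (u : TangentSpace 𝓘(ℝ, E₁) p) :
    pullbackConnection F V p u =
      ofCoords (F p) (F p) (mvfderiv 𝓘(ℝ, E₁) (fun q ↦ coords (F p) (F q) (V q)) p u) +
        christoffel (F p) (differential E₁ E₂ F p u) (V p) := by
  have : (fun q : M₁ ↦ (trivializationAt E₂ (TangentSpace 𝓘(ℝ, E₂)) (F p) ⟨F q, V q⟩).2)
      =ᶠ[𝓝 p] fun q ↦ coords (F p) (F q) (V q) := by
    filter_upwards [eventually_map_mem_chart_source (E₂ := E₂) hF] with q hq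
    exact trivializationAt_snd hq _
  rw [pullbackConnection, this.mvfderiv_eq]
  rfl

variable [IsContMDiffRiemannianBundle 𝓘(ℝ, E₂) ∞ E₂ (fun p : M₂ ↦ TangentSpace 𝓘(ℝ, E₂) p)]

omit [FiniteDimensional ℝ E₂]
  [IsManifold 𝓘(ℝ, E₁) ∞ M₁] in
lemma mdifferentiableAt_inner_pullback {F : M₁ → M₂} {p : M₁}
    (hF : MDifferentiableAt 𝓘(ℝ, E₁) 𝓘(ℝ, E₂) F p)
    {V W : Π q : M₁, TangentSpace 𝓘(ℝ, E₂) (F q)}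
    (hV : MDifferentiableAt 𝓘(ℝ, E₁) 𝓘(ℝ, E₂) (fun q ↦ coords (F p) (F q) (V q)) p)
    (hW : MDifferentiableAt 𝓘(ℝ, E₁) 𝓘(ℝ, E₂) (fun q ↦ coords (F p) (F q) (W q)) p) :
    MDifferentiableAt 𝓘(ℝ, E₁) 𝓘(ℝ) (fun q ↦ inner ℝ (V q) (W q)) p := by
  obtain ⟨G, hd, hG⟩ := exists_metric_coords (E := E₂) (F p)
  exact (((hd.comp p hF).clm_apply hV).clm_apply hW).congr_of_eventuallyEq
    (inner_eventuallyEq_pullback hF.continuousAt hG V W)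

/-- The pullback connection is compatible with the metric. -/
lemma mvfderiv_inner_pullback {F : M₁ → M₂} {p : M₁}
    (hF : MDifferentiableAt 𝓘(ℝ, E₁) 𝓘(ℝ, E₂) F p)
    {V W : Π q : M₁, TangentSpace 𝓘(ℝ, E₂) (F q)}
    (hV : MDifferentiableAt 𝓘(ℝ, E₁) 𝓘(ℝ, E₂) (fun q ↦ coords (F p) (F q) (V q)) p)
    (hW : MDifferentiableAt 𝓘(ℝ, E₁) 𝓘(ℝ, E₂) (fun q ↦ coords (F p) (F q) (W q)) p)
    (u : TangentSpace 𝓘(ℝ, E₁) p) :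
    mvfderiv 𝓘(ℝ, E₁) (fun q ↦ inner ℝ (V q) (W q)) p u =
      inner ℝ (pullbackConnection F V p u) (W p) + inner ℝ (V p) (pullbackConnection F W p u) := by
  obtain ⟨G, hd, hG⟩ := exists_metric_coords (E := E₂) (F p)
  have hs := mem_chart_source E₂ (F p)
  have hev := inner_eventuallyEq_pullback hF.continuousAt hG V W
  have hc : MDifferentiableAt 𝓘(ℝ, E₁) 𝓘(ℝ, E₂ →L[ℝ] E₂ →L[ℝ] ℝ) (G ∘ F) p := hd.comp p hF
  have hch : mvfderiv 𝓘(ℝ, E₁) (G ∘ F) p u =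
      mvfderiv 𝓘(ℝ, E₂) G (F p) (differential E₁ E₂ F p u) :=
    congr($(mfderiv_comp p hd hF) u)
  rw [hev.mvfderiv_eq (E := E₁), mvfderiv_clm_apply (hc.clm_apply hV) hW, mvfderiv_clm_apply hc hV,
    hch, pullbackConnection_eq hF.continuousAt, pullbackConnection_eq hF.continuousAt]
  simp only [add_apply, ← metricDeriv_eq hd hG, inner_add_left, inner_add_right,
    Function.comp_apply, hG _ hs, ofCoords_coords hs, ← inner_christoffel_add]
  ring

end PullbackConnection

/-! ### The second fundamental form as a symmetric bilinear map -/

section SecondFundamentalForm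

variable {E₁ : Type*} [NormedAddCommGroup E₁] [NormedSpace ℝ E₁] [FiniteDimensional ℝ E₁]
  {E₂ : Type*} [NormedAddCommGroup E₂] [NormedSpace ℝ E₂] [FiniteDimensional ℝ E₂]
  {M₁ : Type*} [TopologicalSpace M₁] [ChartedSpace E₁ M₁] [IsManifold 𝓘(ℝ, E₁) ∞ M₁]
  {M₂ : Type*} [TopologicalSpace M₂] [ChartedSpace E₂ M₂] [IsManifold 𝓘(ℝ, E₂) ∞ M₂]
  [RiemannianBundle (fun p : M₁ ↦ TangentSpace 𝓘(ℝ, E₁) p)]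

lemma leviCivita_eq (Y : Π q : M₁, TangentSpace 𝓘(ℝ, E₁) q) (p : M₁) (u : TangentSpace 𝓘(ℝ, E₁) p) :
    leviCivita Y p u = ofCoords p p (mvfderiv 𝓘(ℝ, E₁) (fun q ↦ coords p q (Y q)) p u) +
      christoffel p u (Y p) := by
  have : (fun q : M₁ ↦ (trivializationAt E₁ (TangentSpace 𝓘(ℝ, E₁)) p ⟨q, Y q⟩).2)
      =ᶠ[𝓝 p] fun q ↦ coords p q (Y q) := by
    filter_upwards [eventually_mem_chart_source E₁ p] with q hq
    exact trivializationAt_snd hq _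
  rw [leviCivita, this.mvfderiv_eq]
  rfl

lemma leviCivita_coordField (p : M₁) (u v : TangentSpace 𝓘(ℝ, E₁) p) :
    leviCivita (fun q ↦ coordField v q) p u = christoffel p u v := by
  have : (fun q : M₁ ↦ coords p q (coordField v q)) =ᶠ[𝓝 p] fun _ ↦ coords p p v := by
    filter_upwards [eventually_mem_chart_source E₁ p] with q hq
    rw [coordField_eq v hq, coords_ofCoords hq]
  rw [leviCivita_eq, this.mvfderiv_eq (E := E₁), mvfderiv_const, coordField_self]
  simp

variable [RiemannianBundle (fun p : M₂ ↦ TangentSpace 𝓘(ℝ, E₂) p)]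

omit [FiniteDimensional ℝ E₂] [RiemannianBundle (fun p : M₁ ↦ TangentSpace 𝓘(ℝ, E₁) p)]
  [RiemannianBundle (fun p : M₂ ↦ TangentSpace 𝓘(ℝ, E₂) p)] in
lemma coords_differential_coordField {F : M₁ → M₂} {p : M₁}
    (v : TangentSpace 𝓘(ℝ, E₁) p) :
    (fun q ↦ coords (F p) (F q) (differential E₁ E₂ F q (coordField v q))) =ᶠ[𝓝 p]
      fun q ↦ jacobian F p q (coords p p v) := by
  filter_upwards [eventually_mem_chart_source E₁ p] with q hq
  rw [coordField_eq v hq, jacobian_apply]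

omit [FiniteDimensional ℝ E₂] [RiemannianBundle (fun p : M₁ ↦ TangentSpace 𝓘(ℝ, E₁) p)]
  [RiemannianBundle (fun p : M₂ ↦ TangentSpace 𝓘(ℝ, E₂) p)] in
lemma mdifferentiableAt_coords_differential {F : M₁ → M₂} {p : M₁}
    (hF : ContMDiffAt 𝓘(ℝ, E₁) 𝓘(ℝ, E₂) ∞ F p) (v : TangentSpace 𝓘(ℝ, E₁) p) :
    MDifferentiableAt 𝓘(ℝ, E₁) 𝓘(ℝ, E₂)
      (fun q ↦ coords (F p) (F q) (differential E₁ E₂ F q (coordField v q))) p :=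
  (((contMDiffAt_jacobian hF).mdifferentiableAt (by simp)).clm_apply
    mdifferentiableAt_const).congr_of_eventuallyEq (coords_differential_coordField v)

/-- The second fundamental form in charts. -/
lemma secondFundamentalForm_eq {F : M₁ → M₂} {p : M₁}
    (hF : ContMDiffAt 𝓘(ℝ, E₁) 𝓘(ℝ, E₂) ∞ F p) (u v : TangentSpace 𝓘(ℝ, E₁) p) :
    secondFundamentalForm E₁ E₂ F p u v =
      ofCoords (F p) (F p) (mvfderiv 𝓘(ℝ, E₁) (jacobian F p) p u (coords p p v)) +
        christoffel (F p) (differential E₁ E₂ F p u) (differential E₁ E₂ F p v) -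
        differential E₁ E₂ F p (christoffel p u v) := by
  rw [secondFundamentalForm, pullbackConnection_eq hF.continuousAt, leviCivita_coordField,
    (coords_differential_coordField v).mvfderiv_eq (E := E₁), coordField_self,
    mvfderiv_clm_apply ((contMDiffAt_jacobian hF).mdifferentiableAt (by simp))
      mdifferentiableAt_const, mvfderiv_const]
  simp

variable [IsContMDiffRiemannianBundle 𝓘(ℝ, E₁) ∞ E₁ (fun p : M₁ ↦ TangentSpace 𝓘(ℝ, E₁) p)]
  [IsContMDiffRiemannianBundle 𝓘(ℝ, E₂) ∞ E₂ (fun p : M₂ ↦ TangentSpace 𝓘(ℝ, E₂) p)]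

lemma secondFundamentalForm_comm {F : M₁ → M₂} (hF : ContMDiff 𝓘(ℝ, E₁) 𝓘(ℝ, E₂) ∞ F) (p : M₁)
    (u v : TangentSpace 𝓘(ℝ, E₁) p) :
    secondFundamentalForm E₁ E₂ F p u v = secondFundamentalForm E₁ E₂ F p v u := by
  rw [secondFundamentalForm_eq (hF p), secondFundamentalForm_eq (hF p),
    mvfderiv_jacobian_comm hF, christoffel_comm p, christoffel_comm (F p)]

lemma secondFundamentalForm_add_right {F : M₁ → M₂} (hF : ContMDiff 𝓘(ℝ, E₁) 𝓘(ℝ, E₂) ∞ F) (p : M₁)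
    (u v w : TangentSpace 𝓘(ℝ, E₁) p) :
    secondFundamentalForm E₁ E₂ F p u (v + w) =
      secondFundamentalForm E₁ E₂ F p u v + secondFundamentalForm E₁ E₂ F p u w := by
  simp only [secondFundamentalForm_eq (hF p), map_add, christoffel_add_right]
  abel

lemma secondFundamentalForm_smul_right {F : M₁ → M₂} (hF : ContMDiff 𝓘(ℝ, E₁) 𝓘(ℝ, E₂) ∞ F)
    (p : M₁) (c : ℝ) (u v : TangentSpace 𝓘(ℝ, E₁) p) :
    secondFundamentalForm E₁ E₂ F p u (c • v) = c • secondFundamentalForm E₁ E₂ F p u v := by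
  simp only [secondFundamentalForm_eq (hF p), map_smul, christoffel_smul_right, smul_add, smul_sub]

/-- The second fundamental form of `F` at `p` as a bilinear map. -/
noncomputable def secondFundamentalFormₗ {F : M₁ → M₂} (hF : ContMDiff 𝓘(ℝ, E₁) 𝓘(ℝ, E₂) ∞ F)
    (p : M₁) :
    TangentSpace 𝓘(ℝ, E₁) p →ₗ[ℝ] TangentSpace 𝓘(ℝ, E₁) p →ₗ[ℝ] TangentSpace 𝓘(ℝ, E₂) (F p) :=
  LinearMap.mk₂ ℝ (secondFundamentalForm E₁ E₂ F p)
    (fun u v w ↦ by simp only [secondFundamentalForm_comm hF p _ w,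
      secondFundamentalForm_add_right hF])
    (fun c u w ↦ by simp only [secondFundamentalForm_comm hF p _ w,
      secondFundamentalForm_smul_right hF])
    (secondFundamentalForm_add_right hF p)
    (fun c u w ↦ secondFundamentalForm_smul_right hF p c u w)

@[simp] lemma secondFundamentalFormₗ_apply {F : M₁ → M₂}
    (hF : ContMDiff 𝓘(ℝ, E₁) 𝓘(ℝ, E₂) ∞ F) (p : M₁) (u v : TangentSpace 𝓘(ℝ, E₁) p) :
    secondFundamentalFormₗ hF p u v = secondFundamentalForm E₁ E₂ F p u v :=
  rfl

end SecondFundamentalForm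

/-! ### Riemannian maps: the second fundamental form on horizontal vectors -/

section RiemannianMap

variable {E₁ : Type*} [NormedAddCommGroup E₁] [NormedSpace ℝ E₁] [FiniteDimensional ℝ E₁]
  {E₂ : Type*} [NormedAddCommGroup E₂] [NormedSpace ℝ E₂] [FiniteDimensional ℝ E₂]
  {M₁ : Type*} [TopologicalSpace M₁] [ChartedSpace E₁ M₁] [IsManifold 𝓘(ℝ, E₁) ∞ M₁]
  {M₂ : Type*} [TopologicalSpace M₂] [ChartedSpace E₂ M₂] [IsManifold 𝓘(ℝ, E₂) ∞ M₂]
  [RiemannianBundle (fun p : M₁ ↦ TangentSpace 𝓘(ℝ, E₁) p)]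
  [RiemannianBundle (fun p : M₂ ↦ TangentSpace 𝓘(ℝ, E₂) p)]

omit [FiniteDimensional ℝ E₂] [IsManifold 𝓘(ℝ, E₁) ∞ M₁] [IsManifold 𝓘(ℝ, E₂) ∞ M₂] in
lemma mem_horizontalSpace_orthogonal {F : M₁ → M₂} {p : M₁} {x : TangentSpace 𝓘(ℝ, E₁) p} :
    x ∈ (horizontalSpace E₁ E₂ F p)ᗮ ↔ differential E₁ E₂ F p x = 0 := by
  rw [horizontalSpace, Submodule.orthogonal_orthogonal]
  rfl

omit [FiniteDimensional ℝ E₂] [IsManifold 𝓘(ℝ, E₁) ∞ M₁] [IsManifold 𝓘(ℝ, E₂) ∞ M₂]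
  [RiemannianBundle (fun p : M₂ ↦ TangentSpace 𝓘(ℝ, E₂) p)] in
/-- Every tangent vector is the sum of a horizontal and a vertical vector. -/
lemma exists_horizontal_add_vertical (F : M₁ → M₂) (p : M₁) (x : TangentSpace 𝓘(ℝ, E₁) p) :
    ∃ h ∈ horizontalSpace E₁ E₂ F p, ∃ v ∈ (horizontalSpace E₁ E₂ F p)ᗮ, x = h + v := by
  refine ⟨(horizontalSpace E₁ E₂ F p).starProjection x, Submodule.starProjection_apply_mem _ _,
    x - (horizontalSpace E₁ E₂ F p).starProjection x,
    Submodule.sub_starProjection_mem_orthogonal _, by abel⟩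

omit [FiniteDimensional ℝ E₂] [IsManifold 𝓘(ℝ, E₁) ∞ M₁] [IsManifold 𝓘(ℝ, E₂) ∞ M₂] in
lemma differential_mem_rangeDistribution (F : M₁ → M₂) (p : M₁) (x : TangentSpace 𝓘(ℝ, E₁) p) :
    differential E₁ E₂ F p x ∈ rangeDistribution E₁ E₂ F p := by
  obtain ⟨h, hh, v, hv, rfl⟩ := exists_horizontal_add_vertical (E₂ := E₂) F p x
  rw [map_add, mem_horizontalSpace_orthogonal.1 hv, add_zero]
  exact Submodule.mem_map_of_mem hh

namespace IsRiemannianMap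

variable {F : M₁ → M₂} (hF : IsRiemannianMap E₁ E₂ F)
include hF

omit [FiniteDimensional ℝ E₂] [IsManifold 𝓘(ℝ, E₁) ∞ M₁] [IsManifold 𝓘(ℝ, E₂) ∞ M₂] in
/-- The isometry condition extends to pairs of which only one vector is horizontal. -/
lemma inner_differential_right {p : M₁} (x : TangentSpace 𝓘(ℝ, E₁) p)
    {y : TangentSpace 𝓘(ℝ, E₁) p} (hy : y ∈ horizontalSpace E₁ E₂ F p) :
    inner ℝ (differential E₁ E₂ F p x) (differential E₁ E₂ F p y) = inner ℝ x y := by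
  obtain ⟨h, hh, v, hv, rfl⟩ := exists_horizontal_add_vertical (E₂ := E₂) F p x
  rw [map_add, mem_horizontalSpace_orthogonal.1 hv, add_zero, hF.isometric p h hh y hy,
    inner_add_left, Submodule.inner_left_of_mem_orthogonal hy hv, add_zero]

omit [FiniteDimensional ℝ E₂] [IsManifold 𝓘(ℝ, E₁) ∞ M₁] [IsManifold 𝓘(ℝ, E₂) ∞ M₂] in
lemma inner_differential_self_le {p : M₁} (x : TangentSpace 𝓘(ℝ, E₁) p) :
    inner ℝ (differential E₁ E₂ F p x) (differential E₁ E₂ F p x) ≤ inner ℝ x x := by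
  obtain ⟨h, hh, v, hv, rfl⟩ := exists_horizontal_add_vertical (E₂ := E₂) F p x
  rw [map_add, mem_horizontalSpace_orthogonal.1 hv, add_zero, hF.isometric p h hh h hh,
    inner_add_left, inner_add_right, inner_add_right, Submodule.inner_left_of_mem_orthogonal hh hv,
    Submodule.inner_right_of_mem_orthogonal hh hv]
  have := real_inner_self_nonneg (x := v)
  linarith

variable [IsContMDiffRiemannianBundle 𝓘(ℝ, E₁) ∞ E₁ (fun p : M₁ ↦ TangentSpace 𝓘(ℝ, E₁) p)]
  [IsContMDiffRiemannianBundle 𝓘(ℝ, E₂) ∞ E₂ (fun p : M₂ ↦ TangentSpace 𝓘(ℝ, E₂) p)]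

/-- The function `‖X‖² - ‖F_* X‖²` is nonnegative and vanishes where `X` is horizontal, so its
differential vanishes there. -/
lemma inner_secondFundamentalForm_self (p : M₁) (z : TangentSpace 𝓘(ℝ, E₁) p)
    {x : TangentSpace 𝓘(ℝ, E₁) p} (hx : x ∈ horizontalSpace E₁ E₂ F p) :
    inner ℝ (secondFundamentalForm E₁ E₂ F p z x) (differential E₁ E₂ F p x) = 0 := by
  have hV := mdifferentiableAt_coords_differential (hF.smooth p) x
  have hFd : MDifferentiableAt 𝓘(ℝ, E₁) 𝓘(ℝ, E₂) F p := (hF.smooth p).mdifferentiableAt (by simp)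
  have hX : MDifferentiableAt 𝓘(ℝ, E₁) 𝓘(ℝ)
      (fun q : M₁ ↦ inner ℝ (coordField x q) (coordField x q)) p :=
    mdifferentiableAt_inner_coordField x x
  have hFX : MDifferentiableAt 𝓘(ℝ, E₁) 𝓘(ℝ)
      (fun q : M₁ ↦ inner ℝ (differential E₁ E₂ F q (coordField x q))
        (differential E₁ E₂ F q (coordField x q))) p :=
    mdifferentiableAt_inner_pullback hFd hV hV
  set f : M₁ → ℝ := fun q ↦ inner ℝ (coordField x q) (coordField x q) -
    inner ℝ (differential E₁ E₂ F q (coordField x q)) (differential E₁ E₂ F q (coordField x q))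
  have hf : mvfderiv 𝓘(ℝ, E₁) f p z = 0 := by
    have hfp : f p = 0 := by
      simp only [f]
      rw [coordField_self, hF.isometric p x hx x hx, sub_self]
    -- `f ≥ 0` everywhere because `F_*` does not increase lengths.
    have hmin : IsLocalMin (f ∘ (extChartAt 𝓘(ℝ, E₁) p).symm) (extChartAt 𝓘(ℝ, E₁) p p) := by
      refine Filter.Eventually.of_forall fun y ↦ ?_
      rw [Function.comp_apply, Function.comp_apply, extChartAt_to_inv, hfp]
      exact sub_nonneg.2 (hF.inner_differential_self_le _)
    rw [mvfderiv_eq_fderiv (f := f) (hX.sub hFX), hmin.fderiv_eq_zero]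
    rfl
  have h1 : mvfderiv 𝓘(ℝ, E₁) f p z = metricDeriv p z x x -
      mvfderiv 𝓘(ℝ, E₁) (fun q : M₁ ↦ inner ℝ (differential E₁ E₂ F q (coordField x q))
        (differential E₁ E₂ F q (coordField x q))) p z :=
    congr($(mvfderiv_fun_sub hX hFX) z)
  rw [h1, mvfderiv_inner_pullback hFd hV hV, ← inner_christoffel_add] at hf
  simp only [coordField_self] at hf
  rw [secondFundamentalForm, leviCivita_coordField, inner_sub_left,
    hF.inner_differential_right _ hx]
  rw [real_inner_comm _ x, real_inner_comm _ (differential E₁ E₂ F p x)] at hf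
  linarith

/-- The second fundamental form of a Riemannian map takes horizontal pairs to vectors orthogonal
to the range. -/
lemma inner_secondFundamentalForm_differential {p : M₁} {x y : TangentSpace 𝓘(ℝ, E₁) p}
    (hx : x ∈ horizontalSpace E₁ E₂ F p) (hy : y ∈ horizontalSpace E₁ E₂ F p)
    (w : TangentSpace 𝓘(ℝ, E₁) p) :
    inner ℝ (secondFundamentalForm E₁ E₂ F p x y) (differential E₁ E₂ F p w) = 0 := by
  obtain ⟨z, hz, v, hv, rfl⟩ := exists_horizontal_add_vertical (E₂ := E₂) F p w
  rw [map_add, mem_horizontalSpace_orthogonal.1 hv, add_zero]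
  have skew : ∀ a : TangentSpace 𝓘(ℝ, E₁) p, ∀ b ∈ horizontalSpace E₁ E₂ F p,
      ∀ c ∈ horizontalSpace E₁ E₂ F p,
      inner ℝ (secondFundamentalForm E₁ E₂ F p a b) (differential E₁ E₂ F p c) +
        inner ℝ (secondFundamentalForm E₁ E₂ F p a c) (differential E₁ E₂ F p b) = 0 := by
    intro a b hb c hc
    have h := hF.inner_secondFundamentalForm_self p a (add_mem hb hc)
    rw [secondFundamentalForm_add_right hF.smooth, map_add, inner_add_left, inner_add_right,
      inner_add_right, hF.inner_secondFundamentalForm_self p a hb,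
      hF.inner_secondFundamentalForm_self p a hc] at h
    linarith
  -- `⟨B(x, y), F_* z⟩` is symmetric in `x`, `y` and skew in `y`, `z`, so it is zero.
  have h1 := skew x y hy z hz
  have h2 := skew z x hx y hy
  have h3 := skew y z hz x hx
  rw [secondFundamentalForm_comm hF.smooth p z x] at h2
  rw [secondFundamentalForm_comm hF.smooth p y x, secondFundamentalForm_comm hF.smooth p y z] at h3
  linarith

lemma secondFundamentalForm_mem_orthogonal {p : M₁} {x y : TangentSpace 𝓘(ℝ, E₁) p}
    (hx : x ∈ horizontalSpace E₁ E₂ F p) (hy : y ∈ horizontalSpace E₁ E₂ F p) :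
    secondFundamentalForm E₁ E₂ F p x y ∈ (rangeDistribution E₁ E₂ F p)ᗮ := by
  rintro _ ⟨w, -, rfl⟩
  rw [real_inner_comm]
  exact hF.inner_secondFundamentalForm_differential hx hy w

end IsRiemannianMap

end RiemannianMap

/-! ### Holomorphic maps: the second fundamental form on vertical vectors -/

section Holomorphic

variable {E : Type*} [NormedAddCommGroup E] [NormedSpace ℝ E] [FiniteDimensional ℝ E]
  {M : Type*} [TopologicalSpace M] [ChartedSpace E M] [IsManifold 𝓘(ℝ, E) ∞ M]

/-- The matrix at `q` of an endomorphism field in the preferred chart at `p`. -/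
noncomputable def endCoords (J : Π p : M, TangentSpace 𝓘(ℝ, E) p →L[ℝ] TangentSpace 𝓘(ℝ, E) p)
    (p q : M) : E →L[ℝ] E :=
  coords p q ∘L J q ∘L ofCoords p q

omit [FiniteDimensional ℝ E] in
lemma IsAlmostHermitian.mdifferentiableAt_endCoords
    [RiemannianBundle (fun p : M ↦ TangentSpace 𝓘(ℝ, E) p)]
    {J : Π p : M, TangentSpace 𝓘(ℝ, E) p →L[ℝ] TangentSpace 𝓘(ℝ, E) p}
    (hJ : IsAlmostHermitian J) (p : M) :
    MDifferentiableAt 𝓘(ℝ, E) 𝓘(ℝ, E →L[ℝ] E) (endCoords J p) p := by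
  have := hJ.smooth.contMDiffAt (x := p)
  rw [contMDiffAt_hom_bundle] at this
  exact this.2.mdifferentiableAt (by simp)

variable {E₁ : Type*} [NormedAddCommGroup E₁] [NormedSpace ℝ E₁] [FiniteDimensional ℝ E₁]
  {E₂ : Type*} [NormedAddCommGroup E₂] [NormedSpace ℝ E₂] [FiniteDimensional ℝ E₂]
  {M₁ : Type*} [TopologicalSpace M₁] [ChartedSpace E₁ M₁] [IsManifold 𝓘(ℝ, E₁) ∞ M₁]
  {M₂ : Type*} [TopologicalSpace M₂] [ChartedSpace E₂ M₂] [IsManifold 𝓘(ℝ, E₂) ∞ M₂]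
  [RiemannianBundle (fun p : M₁ ↦ TangentSpace 𝓘(ℝ, E₁) p)]
  [RiemannianBundle (fun p : M₂ ↦ TangentSpace 𝓘(ℝ, E₂) p)]
  [IsContMDiffRiemannianBundle 𝓘(ℝ, E₁) ∞ E₁ (fun p : M₁ ↦ TangentSpace 𝓘(ℝ, E₁) p)]
  [IsContMDiffRiemannianBundle 𝓘(ℝ, E₂) ∞ E₂ (fun p : M₂ ↦ TangentSpace 𝓘(ℝ, E₂) p)]
  {J₁ : Π p : M₁, TangentSpace 𝓘(ℝ, E₁) p →L[ℝ] TangentSpace 𝓘(ℝ, E₁) p}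
  {J₂ : Π p : M₂, TangentSpace 𝓘(ℝ, E₂) p →L[ℝ] TangentSpace 𝓘(ℝ, E₂) p}

omit [IsContMDiffRiemannianBundle 𝓘(ℝ, E₁) ∞ E₁ (fun p : M₁ ↦ TangentSpace 𝓘(ℝ, E₁) p)] in
/-- In charts, the Kähler condition reads `(∂_u J) y + Γ(u, J y) = J Γ(u, y)`. -/
lemma IsKaehler.ofCoords_mvfderiv_endCoords (hJ : IsKaehler J₁) (p : M₁)
    (u y : TangentSpace 𝓘(ℝ, E₁) p) :
    ofCoords p p (mvfderiv 𝓘(ℝ, E₁) (endCoords J₁ p) p u (coords p p y)) +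
      christoffel p u (J₁ p y) = J₁ p (christoffel p u y) := by
  have h := hJ.parallel p u (fun q ↦ coordField y q) (contMDiffAt_coordField y)
  have hev : (fun q ↦ coords p q (J₁ q (coordField y q))) =ᶠ[𝓝 p]
      fun q ↦ endCoords J₁ p q (coords p p y) := by
    filter_upwards [eventually_mem_chart_source E₁ p] with q hq
    rw [coordField_eq y hq]
    rfl
  rw [leviCivita_coordField, leviCivita_eq, hev.mvfderiv_eq (E := E₁), coordField_self,
    mvfderiv_clm_apply (hJ.mdifferentiableAt_endCoords p) mdifferentiableAt_const,
    mvfderiv_const] at h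
  simpa using h

omit [IsContMDiffRiemannianBundle 𝓘(ℝ, E₁) ∞ E₁ (fun p : M₁ ↦ TangentSpace 𝓘(ℝ, E₁) p)] in
/-- Complex linearity of the second fundamental form of a holomorphic map out of a Kähler manifold,
in vertical directions, along which the derivative of `J₂` plays no role. -/
lemma secondFundamentalForm_vertical_apply (hJ₁ : IsKaehler J₁) (hJ₂ : IsAlmostHermitian J₂)
    {F : M₁ → M₂} (hF : ContMDiff 𝓘(ℝ, E₁) 𝓘(ℝ, E₂) ∞ F)
    (hol : ∀ (p : M₁) (X : TangentSpace 𝓘(ℝ, E₁) p),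
      J₂ (F p) (differential E₁ E₂ F p X) = differential E₁ E₂ F p (J₁ p X))
    {p : M₁} {u : TangentSpace 𝓘(ℝ, E₁) p} (hu : differential E₁ E₂ F p u = 0)
    (y : TangentSpace 𝓘(ℝ, E₁) p) :
    secondFundamentalForm E₁ E₂ F p u (J₁ p y) =
      J₂ (F p) (secondFundamentalForm E₁ E₂ F p u y) := by
  have hs := mem_chart_source E₁ p
  have hs' := mem_chart_source E₂ (F p)
  have hFd : MDifferentiableAt 𝓘(ℝ, E₁) 𝓘(ℝ, E₂) F p := (hF p).mdifferentiableAt (by simp)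
  have hA := (contMDiffAt_jacobian (hF p)).mdifferentiableAt (by simp)
  have h₁ := hJ₁.mdifferentiableAt_endCoords p
  have h₂ := hJ₂.mdifferentiableAt_endCoords (F p)
  have h₂F : MDifferentiableAt 𝓘(ℝ, E₁) 𝓘(ℝ, E₂ →L[ℝ] E₂) (endCoords J₂ (F p) ∘ F) p :=
    h₂.comp p hFd
  have hch : mvfderiv 𝓘(ℝ, E₁) (endCoords J₂ (F p) ∘ F) p u = 0 := by
    have : mvfderiv 𝓘(ℝ, E₁) (endCoords J₂ (F p) ∘ F) p u =
        mvfderiv 𝓘(ℝ, E₂) (endCoords J₂ (F p)) (F p) (differential E₁ E₂ F p u) :=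
      congr($(mfderiv_comp p h₂ hFd) u)
    rw [this, hu, map_zero]
  set c := coords p p y
  -- `F_* J₁ = J₂ F_*` in charts, to be differentiated along `u`.
  have hev : (fun q ↦ jacobian F p q (endCoords J₁ p q c)) =ᶠ[𝓝 p]
      fun q ↦ (endCoords J₂ (F p) ∘ F) q (jacobian F p q c) := by
    filter_upwards [eventually_mem_chart_source E₁ p,
      eventually_map_mem_chart_source (E₂ := E₂) (hF p).continuousAt] with q hq hq'
    simp only [jacobian_apply, endCoords, Function.comp_apply, ContinuousLinearMap.comp_apply]
    rw [ofCoords_coords hq, ofCoords_coords hq', hol]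
  have key := congr($(hev.mvfderiv_eq (E := E₁)) u)
  rw [mvfderiv_clm_apply hA (h₁.clm_apply mdifferentiableAt_const),
    mvfderiv_clm_apply h₁ mdifferentiableAt_const,
    mvfderiv_clm_apply h₂F (hA.clm_apply mdifferentiableAt_const),
    mvfderiv_clm_apply hA mdifferentiableAt_const, mvfderiv_const, hch] at key
  have key' := congr(ofCoords (F p) (F p) $key)
  simp only [zero_apply, map_zero, zero_add, add_zero, map_add, Function.comp_apply, jacobian_apply,
    endCoords, ContinuousLinearMap.comp_apply, ofCoords_coords hs', ofCoords_coords hs, c] at key'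
  have hΓ : ∀ w, christoffel (F p) (0 : TangentSpace 𝓘(ℝ, E₂) (F p)) w = 0 := fun w ↦ by
    rw [christoffel_comm]
    simpa only [zero_smul] using christoffel_smul_right (F p) 0 w 0
  have hK := congr(differential E₁ E₂ F p $(hJ₁.ofCoords_mvfderiv_endCoords p u y))
  rw [← hol, map_add] at hK
  rw [secondFundamentalForm_eq (hF p), secondFundamentalForm_eq (hF p), hu, hΓ, hΓ, add_zero,
    add_zero, map_sub, ← hK, ← key']
  abel

end Holomorphic

/-! ### Sections of the range distribution -/

section RangeSections

/-- If `σ = A ξ` near `x₀` with `A` continuous at `x₀` and `ξ` bounded by a multiple of `σ`, then at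
a zero of `σ` the derivative of `σ` lies in the range of `A x₀`, in the sense that it is annihilated
by every functional that annihilates this range. -/
lemma apply_fderiv_eq_zero_of_eventually_eq_clm_apply
    {E₀ E₁ E₂ : Type*} [NormedAddCommGroup E₀] [NormedSpace ℝ E₀]
    [NormedAddCommGroup E₁] [NormedSpace ℝ E₁] [NormedAddCommGroup E₂] [NormedSpace ℝ E₂]
    {σ : E₀ → E₂} {A : E₀ → E₁ →L[ℝ] E₂} {ξ : E₀ → E₁} {x₀ : E₀} {C : ℝ}
    (hσ : DifferentiableAt ℝ σ x₀) (h0 : σ x₀ = 0) (hA : ContinuousAt A x₀)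
    (hξ : ∀ᶠ x in 𝓝 x₀, ‖ξ x‖ ≤ C * ‖σ x‖) (h : ∀ᶠ x in 𝓝 x₀, σ x = A x (ξ x))
    (ℓ : E₂ →L[ℝ] ℝ) (hℓ : ∀ v, ℓ (A x₀ v) = 0) (u : E₀) :
    ℓ (fderiv ℝ σ x₀ u) = 0 := by
  have hO : σ =O[𝓝 x₀] fun x ↦ x - x₀ := by
    simpa [h0] using hσ.isBigO_sub
  have hξO : ξ =O[𝓝 x₀] fun x ↦ x - x₀ := (Asymptotics.IsBigO.of_bound C hξ).trans hO
  have hAo : (fun x ↦ ‖ℓ ∘L (A x - A x₀)‖) =o[𝓝 x₀] fun _ ↦ (1 : ℝ) := by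
    rw [Asymptotics.isLittleO_one_iff]
    have : ContinuousAt (fun x ↦ ‖ℓ ∘L (A x - A x₀)‖) x₀ := by fun_prop
    simpa [ContinuousAt] using this
  have ho : (fun x ↦ ℓ (σ x)) =o[𝓝 x₀] fun x ↦ x - x₀ := by
    have h1 : (fun x ↦ ℓ (σ x)) =O[𝓝 x₀] fun x ↦ ‖ℓ ∘L (A x - A x₀)‖ * ‖ξ x‖ := by
      refine Asymptotics.IsBigO.of_bound 1 ?_
      filter_upwards [h] with x hx
      have : ℓ (σ x) = (ℓ ∘L (A x - A x₀)) (ξ x) := by simp [hx, hℓ]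
      rw [this, one_mul, norm_mul, norm_norm, norm_norm]
      exact ContinuousLinearMap.le_opNorm _ _
    have h2 := hAo.mul_isBigO hξO.norm_norm
    simp only [one_mul] at h2
    exact (h1.trans_isLittleO h2).of_norm_right
  have hd : HasFDerivAt (fun x ↦ ℓ (σ x)) (0 : E₀ →L[ℝ] ℝ) x₀ := by
    refine .of_isLittleO ?_
    simpa [h0] using ho
  have := (ℓ.hasFDerivAt.comp x₀ hσ.hasFDerivAt).unique hd
  exact congr($this u)

variable {E₁ : Type*} [NormedAddCommGroup E₁] [NormedSpace ℝ E₁] [FiniteDimensional ℝ E₁]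
  {E₂ : Type*} [NormedAddCommGroup E₂] [NormedSpace ℝ E₂] [FiniteDimensional ℝ E₂]
  {M₁ : Type*} [TopologicalSpace M₁] [ChartedSpace E₁ M₁] [IsManifold 𝓘(ℝ, E₁) ∞ M₁]
  {M₂ : Type*} [TopologicalSpace M₂] [ChartedSpace E₂ M₂] [IsManifold 𝓘(ℝ, E₂) ∞ M₂]
  [RiemannianBundle (fun p : M₁ ↦ TangentSpace 𝓘(ℝ, E₁) p)]
  [RiemannianBundle (fun p : M₂ ↦ TangentSpace 𝓘(ℝ, E₂) p)]
  [IsContMDiffRiemannianBundle 𝓘(ℝ, E₁) ∞ E₁ (fun p : M₁ ↦ TangentSpace 𝓘(ℝ, E₁) p)]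
  [IsContMDiffRiemannianBundle 𝓘(ℝ, E₂) ∞ E₂ (fun p : M₂ ↦ TangentSpace 𝓘(ℝ, E₂) p)]

omit [FiniteDimensional ℝ E₂] in
/-- At a zero, the derivative of a section of the range distribution of a Riemannian map is tangent
to the distribution. -/
lemma IsRiemannianMap.inner_ofCoords_mvfderiv {F : M₁ → M₂} (hF : IsRiemannianMap E₁ E₂ F)
    {p : M₁} {W : Π q : M₁, TangentSpace 𝓘(ℝ, E₂) (F q)}
    (hW : MDifferentiableAt 𝓘(ℝ, E₁) 𝓘(ℝ, E₂) (fun q ↦ coords (F p) (F q) (W q)) p)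
    (hWr : ∀ q, W q ∈ rangeDistribution E₁ E₂ F q) (hW0 : W p = 0)
    {n : TangentSpace 𝓘(ℝ, E₂) (F p)} (hn : n ∈ (rangeDistribution E₁ E₂ F p)ᗮ)
    (u : TangentSpace 𝓘(ℝ, E₁) p) :
    inner ℝ n (ofCoords (F p) (F p)
      (mvfderiv 𝓘(ℝ, E₁) (fun q ↦ coords (F p) (F q) (W q)) p u)) = 0 := by
  -- `X` is the horizontal lift of `W`; it has the same length, so in charts it is bounded by `W`.
  choose X hXh hXW using fun q ↦ Submodule.mem_map.1 (hWr q)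
  replace hXW : ∀ q, differential E₁ E₂ F q (X q) = W q := hXW
  have hnorm : ∀ q, ‖X q‖ = ‖W q‖ := fun q ↦ by
    have := hF.isometric q (X q) (hXh q) (X q) (hXh q)
    rw [hXW, real_inner_self_eq_norm_sq, real_inner_self_eq_norm_sq] at this
    exact ((sq_eq_sq₀ (norm_nonneg _) (norm_nonneg _)).1 this).symm
  obtain ⟨C₁, hC₁, hC₁'⟩ := eventually_norm_trivializationAt_lt E₁
    (fun p : M₁ ↦ TangentSpace 𝓘(ℝ, E₁) p) p
  obtain ⟨C₂, hC₂, hC₂'⟩ := eventually_norm_symmL_trivializationAt_lt E₂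
    (fun p : M₂ ↦ TangentSpace 𝓘(ℝ, E₂) p) (F p)
  have hcont := (hF.smooth p).continuousAt
  have hbound : ∀ᶠ q in 𝓝 p, ‖coords p q (X q)‖ ≤ C₁ * C₂ * ‖coords (F p) (F q) (W q)‖ := by
    filter_upwards [hC₁', hcont.eventually hC₂',
      eventually_map_mem_chart_source (E₂ := E₂) hcont] with q h1 h2 hq
    calc ‖coords p q (X q)‖ ≤ C₁ * ‖X q‖ :=
          ContinuousLinearMap.le_of_opNorm_le _ h1.le _
      _ = C₁ * ‖ofCoords (F p) (F q) (coords (F p) (F q) (W q))‖ := by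
          rw [ofCoords_coords hq, hnorm]
      _ ≤ C₁ * (C₂ * ‖coords (F p) (F q) (W q)‖) := by
          gcongr
          exact ContinuousLinearMap.le_of_opNorm_le _ h2.le _
      _ = _ := by ring
  have heq : ∀ᶠ q in 𝓝 p, coords (F p) (F q) (W q) = jacobian F p q (coords p q (X q)) := by
    filter_upwards [eventually_mem_chart_source E₁ p] with q hq
    rw [jacobian_apply, ofCoords_coords hq]
    rw [hXW]
  have hsymm : Tendsto (extChartAt 𝓘(ℝ, E₁) p).symm (𝓝 (extChartAt 𝓘(ℝ, E₁) p p)) (𝓝 p) := by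
    simpa [ContinuousAt] using continuousAt_extChartAt_symm (I := 𝓘(ℝ, E₁)) p
  have hA := ((contMDiffAt_jacobian (hF.smooth p)).mdifferentiableAt
    (by simp)).differentiableAt_comp_extChartAt_symm.continuousAt
  rw [mvfderiv_eq_fderiv hW]
  refine apply_fderiv_eq_zero_of_eventually_eq_clm_apply hW.differentiableAt_comp_extChartAt_symm
    ?_ hA (hsymm.eventually hbound) (hsymm.eventually heq)
    (innerSL ℝ n ∘L ofCoords (F p) (F p)) (fun v ↦ ?_) (coords p p u)
  · have : ∀ q, q = p → coords (F p) (F q) (W q) = 0 := by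
      rintro _ rfl
      rw [hW0, map_zero]
    exact this _ (extChartAt_to_inv p)
  · have : (jacobian (E₁ := E₁) (E₂ := E₂) F p ∘ (extChartAt 𝓘(ℝ, E₁) p).symm)
        (extChartAt 𝓘(ℝ, E₁) p p) = jacobian F p p := by
      rw [Function.comp_apply, extChartAt_to_inv]
    rw [this]
    simp only [ContinuousLinearMap.comp_apply, jacobian_apply,
      ofCoords_coords (mem_chart_source E₂ (F p)), innerSL_apply_apply]
    exact Submodule.inner_left_of_mem_orthogonal (differential_mem_rangeDistribution F p _) hn

/-- The part of `∇^F_u V` normal to the range distribution does not depend on the section `V` of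
this distribution, but only on `V p`. -/
lemma IsRiemannianMap.starProjection_pullbackConnection {F : M₁ → M₂}
    (hF : IsRiemannianMap E₁ E₂ F) {p : M₁} {V : Π q : M₁, TangentSpace 𝓘(ℝ, E₂) (F q)}
    (hV : ContMDiffAt 𝓘(ℝ, E₁) (𝓘(ℝ, E₂).prod 𝓘(ℝ, E₂)) ∞
      (fun q ↦ (⟨F q, V q⟩ : TangentBundle 𝓘(ℝ, E₂) M₂)) p)
    (hVr : ∀ q, V q ∈ rangeDistribution E₁ E₂ F q) {u x : TangentSpace 𝓘(ℝ, E₁) p}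
    (hu : u ∈ horizontalSpace E₁ E₂ F p) (hx : x ∈ horizontalSpace E₁ E₂ F p)
    (hVx : V p = differential E₁ E₂ F p x) :
    ((rangeDistribution E₁ E₂ F p)ᗮ).starProjection (pullbackConnection F V p u) =
      secondFundamentalForm E₁ E₂ F p u x := by
  have hcont := (hF.smooth p).continuousAt
  have hVc : MDifferentiableAt 𝓘(ℝ, E₁) 𝓘(ℝ, E₂) (fun q ↦ coords (F p) (F q) (V q)) p := by
    refine ((contMDiffAt_totalSpace.1 hV).2.mdifferentiableAt
      (by simp)).congr_of_eventuallyEq ?_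
    filter_upwards [eventually_map_mem_chart_source (E₂ := E₂) hcont] with q hq
    exact (trivializationAt_snd hq _).symm
  have hXc := mdifferentiableAt_coords_differential (hF.smooth p) x
  set X : Π q : M₁, TangentSpace 𝓘(ℝ, E₂) (F q) := fun q ↦ differential E₁ E₂ F q (coordField x q)
    with hX
  have hXp : X p = differential E₁ E₂ F p x := by rw [hX]; simp only [coordField_self]
  -- `W` is a section of the range distribution that vanishes at `p`.
  set W : Π q : M₁, TangentSpace 𝓘(ℝ, E₂) (F q) := fun q ↦ V q - X q
  have hWe : (fun q ↦ coords (F p) (F q) (W q)) =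
      fun q ↦ coords (F p) (F q) (V q) - coords (F p) (F q) (X q) := by
    ext q
    exact map_sub _ _ _
  have hWc : MDifferentiableAt 𝓘(ℝ, E₁) 𝓘(ℝ, E₂) (fun q ↦ coords (F p) (F q) (W q)) p := by
    rw [hWe]
    exact hVc.sub hXc
  have hB := hF.secondFundamentalForm_mem_orthogonal hu hx
  have hdecomp : pullbackConnection F V p u - secondFundamentalForm E₁ E₂ F p u x =
      ofCoords (F p) (F p) (mvfderiv 𝓘(ℝ, E₁) (fun q ↦ coords (F p) (F q) (W q)) p u) +
        differential E₁ E₂ F p (christoffel p u x) := by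
    have hd : mvfderiv 𝓘(ℝ, E₁) (fun q ↦ coords (F p) (F q) (W q)) p u =
        mvfderiv 𝓘(ℝ, E₁) (fun q ↦ coords (F p) (F q) (V q)) p u -
          mvfderiv 𝓘(ℝ, E₁) (fun q ↦ coords (F p) (F q) (X q)) p u := by
      rw [hWe]
      exact congr($(mvfderiv_fun_sub hVc hXc) u)
    rw [secondFundamentalForm, leviCivita_coordField, pullbackConnection_eq hcont,
      pullbackConnection_eq hcont, hd, map_sub, hVx, coordField_self]
    abel
  have hmem : pullbackConnection F V p u - secondFundamentalForm E₁ E₂ F p u x ∈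
      (rangeDistribution E₁ E₂ F p)ᗮᗮ := by
    rw [hdecomp]
    refine add_mem (fun n hn ↦ ?_) (Submodule.le_orthogonal_orthogonal _
      (differential_mem_rangeDistribution F p _))
    refine hF.inner_ofCoords_mvfderiv hWc (fun q ↦ sub_mem (hVr q)
      (differential_mem_rangeDistribution F q _)) ?_ hn u
    simp only [W, hXp, hVx, sub_self]
  have h1 := (Submodule.starProjection_apply_eq_zero_iff _).2 hmem
  rw [map_sub, Submodule.starProjection_eq_self_iff.2 hB, sub_eq_zero] at h1
  exact h1

omit [FiniteDimensional ℝ E₂] [RiemannianBundle (fun p : M₁ ↦ TangentSpace 𝓘(ℝ, E₁) p)]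
  [RiemannianBundle (fun p : M₂ ↦ TangentSpace 𝓘(ℝ, E₂) p)]
  [IsContMDiffRiemannianBundle 𝓘(ℝ, E₁) ∞ E₁ (fun p : M₁ ↦ TangentSpace 𝓘(ℝ, E₁) p)]
  [IsContMDiffRiemannianBundle 𝓘(ℝ, E₂) ∞ E₂ (fun p : M₂ ↦ TangentSpace 𝓘(ℝ, E₂) p)] in
/-- The image under `F_*` of a coordinate field is a smooth section of `F⁻¹TM₂`. -/
lemma contMDiffAt_differential_coordField {F : M₁ → M₂}
    (hF : ContMDiff 𝓘(ℝ, E₁) 𝓘(ℝ, E₂) ∞ F) {p : M₁} (x : TangentSpace 𝓘(ℝ, E₁) p) :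
    ContMDiffAt 𝓘(ℝ, E₁) (𝓘(ℝ, E₂).prod 𝓘(ℝ, E₂)) ∞ (fun q ↦
      (⟨F q, differential E₁ E₂ F q (coordField x q)⟩ : TangentBundle 𝓘(ℝ, E₂) M₂)) p := by
  refine contMDiffAt_totalSpace.2 ⟨hF p, ?_⟩
  refine ((contMDiffAt_jacobian (hF p)).clm_apply
    (contMDiffAt_const (c := coords p p x))).congr_of_eventuallyEq ?_
  filter_upwards [coords_differential_coordField (E₂ := E₂) (F := F) x,
    eventually_map_mem_chart_source (E₂ := E₂) (hF p).continuousAt] with q hq hq'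
  rw [trivializationAt_snd hq', hq]

end RangeSections

/-! ### Traces in orthonormal bases -/

section Trace

/-- The trace of a vector-valued bilinear map does not depend on the orthonormal basis. -/
lemma OrthonormalBasis.sum_bilin_eq {V W ι κ : Type*} [NormedAddCommGroup V]
    [InnerProductSpace ℝ V] [AddCommGroup W] [Module ℝ W] [Fintype ι] [Fintype κ]
    (b : OrthonormalBasis ι ℝ V) (c : OrthonormalBasis κ ℝ V) (B : V →ₗ[ℝ] V →ₗ[ℝ] W) :
    ∑ i, B (b i) (b i) = ∑ j, B (c j) (c j) := by
  have h1 : ∀ i, B (b i) (b i) = ∑ j, inner ℝ (c j) (b i) • B (c j) (b i) := fun i ↦ by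
    conv_lhs => enter [1]; rw [← c.sum_repr' (b i)]
    simp
  have h2 : ∀ j, B (c j) (c j) = ∑ i, inner ℝ (b i) (c j) • B (c j) (b i) := fun j ↦ by
    conv_lhs => enter [2]; rw [← b.sum_repr' (c j)]
    simp
  simp only [h1, h2]
  rw [Finset.sum_comm]
  simp only [real_inner_comm]

/-- Orthonormal bases of a subspace and of its orthogonal complement compute the trace together. -/
lemma OrthonormalBasis.sum_bilin_eq_add {V W ι κ μ : Type*} [NormedAddCommGroup V]
    [InnerProductSpace ℝ V] [FiniteDimensional ℝ V] [AddCommGroup W] [Module ℝ W]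
    [Fintype ι] [Fintype κ] [Fintype μ] (b : OrthonormalBasis ι ℝ V) {H : Submodule ℝ V}
    {e : κ → V} {f : μ → V} (he : Orthonormal ℝ e) (hf : Orthonormal ℝ f)
    (heH : Submodule.span ℝ (Set.range e) = H) (hfH : Submodule.span ℝ (Set.range f) = Hᗮ)
    (B : V →ₗ[ℝ] V →ₗ[ℝ] W) :
    ∑ i, B (b i) (b i) = ∑ j, B (e j) (e j) + ∑ j, B (f j) (f j) := by
  have he' : ∀ j, e j ∈ H := fun j ↦ heH ▸ Submodule.subset_span (Set.mem_range_self j)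
  have hf' : ∀ j, f j ∈ Hᗮ := fun j ↦ hfH ▸ Submodule.subset_span (Set.mem_range_self j)
  have hon : Orthonormal ℝ (Sum.elim e f) := by
    refine ⟨by rintro (i | i); exacts [he.1 i, hf.1 i], ?_⟩
    rintro (i | i) (j | j) hij
    · exact he.2 fun h ↦ hij (h ▸ rfl)
    · exact Submodule.inner_right_of_mem_orthogonal (he' i) (hf' j)
    · exact Submodule.inner_left_of_mem_orthogonal (he' j) (hf' i)
    · exact hf.2 fun h ↦ hij (h ▸ rfl)
  have hsp : ⊤ ≤ Submodule.span ℝ (Set.range (Sum.elim e f)) := by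
    rw [Set.Sum.elim_range, Submodule.span_union, heH, hfH,
      Submodule.sup_orthogonal_of_hasOrthogonalProjection]
  rw [b.sum_bilin_eq (OrthonormalBasis.mk hon hsp) B]
  simp [Fintype.sum_sum_type]

lemma Submodule.exists_orthonormal_span_eq {V : Type*} [NormedAddCommGroup V]
    [InnerProductSpace ℝ V] [FiniteDimensional ℝ V] (H : Submodule ℝ V) :
    ∃ (k : ℕ) (e : Fin k → V), Orthonormal ℝ e ∧ Submodule.span ℝ (Set.range e) = H := by
  have b := stdOrthonormalBasis ℝ H
  refine ⟨_, fun i ↦ (b i : V), b.orthonormal.comp_linearIsometry H.subtypeₗᵢ, ?_⟩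
  have := congr(Submodule.map H.subtype $(b.toBasis.span_eq))
  rw [Submodule.map_span, ← Set.range_comp, Submodule.map_subtype_top] at this
  simpa [Function.comp_def] using this

/-- A linear isometry `J` with `J² = -1` permutes the orthonormal bases of an invariant subspace. -/
lemma orthonormal_comp_and_span_eq {V κ : Type*} [NormedAddCommGroup V] [InnerProductSpace ℝ V]
    {J : V →ₗ[ℝ] V} (hJ : ∀ x y, inner ℝ (J x) (J y) = inner ℝ x y) (hJJ : ∀ x, J (J x) = -x)
    {K : Submodule ℝ V} (hK : ∀ x ∈ K, J x ∈ K) {f : κ → V} (hf : Orthonormal ℝ f)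
    (hfK : Submodule.span ℝ (Set.range f) = K) :
    Orthonormal ℝ (J ∘ f) ∧ Submodule.span ℝ (Set.range (J ∘ f)) = K := by
  refine ⟨hf.comp_linearIsometry (J.isometryOfInner hJ), ?_⟩
  rw [Set.range_comp, ← Submodule.map_span, hfK]
  refine le_antisymm (Submodule.map_le_iff_le_comap.2 hK) fun x hx ↦ ?_
  exact ⟨-J x, neg_mem (hK x hx), by rw [map_neg, hJJ, neg_neg]⟩

end Trace

/-! ### The tension field -/

section TensionField

variable {E₁ : Type*} [NormedAddCommGroup E₁] [NormedSpace ℝ E₁] [FiniteDimensional ℝ E₁]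
  {E₂ : Type*} [NormedAddCommGroup E₂] [NormedSpace ℝ E₂] [FiniteDimensional ℝ E₂]
  {M₁ : Type*} [TopologicalSpace M₁] [ChartedSpace E₁ M₁] [IsManifold 𝓘(ℝ, E₁) ∞ M₁]
  {M₂ : Type*} [TopologicalSpace M₂] [ChartedSpace E₂ M₂] [IsManifold 𝓘(ℝ, E₂) ∞ M₂]
  [RiemannianBundle (fun p : M₁ ↦ TangentSpace 𝓘(ℝ, E₁) p)]
  [RiemannianBundle (fun p : M₂ ↦ TangentSpace 𝓘(ℝ, E₂) p)]

variable [IsContMDiffRiemannianBundle 𝓘(ℝ, E₁) ∞ E₁ (fun p : M₁ ↦ TangentSpace 𝓘(ℝ, E₁) p)]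
  [IsContMDiffRiemannianBundle 𝓘(ℝ, E₂) ∞ E₂ (fun p : M₂ ↦ TangentSpace 𝓘(ℝ, E₂) p)]
  {J₁ : Π p : M₁, TangentSpace 𝓘(ℝ, E₁) p →L[ℝ] TangentSpace 𝓘(ℝ, E₁) p}
  {J₂ : Π p : M₂, TangentSpace 𝓘(ℝ, E₂) p →L[ℝ] TangentSpace 𝓘(ℝ, E₂) p}

/-- The tension field of a holomorphic Riemannian map out of a Kähler manifold is the horizontal
trace of the second fundamental form. -/
lemma IsHolomorphicRiemannianMap.tensionField_eq_sum (hJ₁ : IsKaehler J₁)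
    (hJ₂ : IsAlmostHermitian J₂) {F : M₁ → M₂} (hF : IsHolomorphicRiemannianMap J₁ J₂ F) (p : M₁)
    {k : ℕ} {e : Fin k → TangentSpace 𝓘(ℝ, E₁) p} (he : Orthonormal ℝ e)
    (hspan : Submodule.span ℝ (Set.range e) = horizontalSpace E₁ E₂ F p) :
    tensionField E₁ E₂ F p = ∑ a, secondFundamentalForm E₁ E₂ F p (e a) (e a) := by
  obtain ⟨l, f, hf, hfspan⟩ :=
    Submodule.exists_orthonormal_span_eq (horizontalSpace E₁ E₂ F p)ᗮ
  have hfv : ∀ j, differential E₁ E₂ F p (f j) = 0 := fun j ↦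
    mem_horizontalSpace_orthogonal.1 (hfspan ▸ Submodule.subset_span (Set.mem_range_self j))
  have hJv : ∀ x, differential E₁ E₂ F p x = 0 → differential E₁ E₂ F p (J₁ p x) = 0 :=
    fun x hx ↦ by rw [← hF.holomorphic, hx, map_zero]
  obtain ⟨hJf, hJspan⟩ := orthonormal_comp_and_span_eq (J := (J₁ p).toLinearMap)
    (hJ₁.isometric p) (hJ₁.sq p) (fun x hx ↦ mem_horizontalSpace_orthogonal.2
      (hJv x (mem_horizontalSpace_orthogonal.1 hx))) hf hfspan
  set b := stdOrthonormalBasis ℝ (TangentSpace 𝓘(ℝ, E₁) p)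
  -- `f` and `J₁ ∘ f` are both orthonormal bases of the vertical space.
  have h1 := b.sum_bilin_eq_add he hf hspan hfspan (secondFundamentalFormₗ hF.smooth p)
  have h2 := b.sum_bilin_eq_add he hJf hspan hJspan (secondFundamentalFormₗ hF.smooth p)
  simp only [secondFundamentalFormₗ_apply] at h1 h2
  have hneg : ∀ j, secondFundamentalForm E₁ E₂ F p (J₁ p (f j)) (J₁ p (f j)) =
      -secondFundamentalForm E₁ E₂ F p (f j) (f j) := fun j ↦ by
    rw [secondFundamentalForm_vertical_apply hJ₁ hJ₂ hF.smooth hF.holomorphic (hJv _ (hfv j)),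
      secondFundamentalForm_comm hF.smooth,
      secondFundamentalForm_vertical_apply hJ₁ hJ₂ hF.smooth hF.holomorphic (hfv j), hJ₂.sq]
  have h3 : ∑ j, secondFundamentalForm E₁ E₂ F p (f j) (f j) = 0 := by
    have h4 := add_left_cancel (h1.symm.trans h2)
    simp only [Function.comp_apply, ContinuousLinearMap.coe_coe, hneg, Finset.sum_neg_distrib] at h4
    rw [eq_neg_iff_add_eq_zero, ← two_smul ℝ] at h4
    exact (smul_eq_zero.1 h4).resolve_left two_ne_zero
  rw [tensionField, h1, h3, add_zero]

end TensionField

theorem theorem3p1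
    {E₁ : Type*} [NormedAddCommGroup E₁] [NormedSpace ℝ E₁] [FiniteDimensional ℝ E₁]
    {E₂ : Type*} [NormedAddCommGroup E₂] [NormedSpace ℝ E₂] [FiniteDimensional ℝ E₂]
    {M₁ : Type*} [TopologicalSpace M₁] [ChartedSpace E₁ M₁] [IsManifold 𝓘(ℝ, E₁) ∞ M₁]
    {M₂ : Type*} [TopologicalSpace M₂] [ChartedSpace E₂ M₂] [IsManifold 𝓘(ℝ, E₂) ∞ M₂]
    [RiemannianBundle (fun p : M₁ ↦ TangentSpace 𝓘(ℝ, E₁) p)]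
    [IsContMDiffRiemannianBundle 𝓘(ℝ, E₁) ∞ E₁ (fun p : M₁ ↦ TangentSpace 𝓘(ℝ, E₁) p)]
    [RiemannianBundle (fun p : M₂ ↦ TangentSpace 𝓘(ℝ, E₂) p)]
    [IsContMDiffRiemannianBundle 𝓘(ℝ, E₂) ∞ E₂ (fun p : M₂ ↦ TangentSpace 𝓘(ℝ, E₂) p)]
    (J₁ : Π p : M₁, TangentSpace 𝓘(ℝ, E₁) p →L[ℝ] TangentSpace 𝓘(ℝ, E₁) p)
    (J₂ : Π p : M₂, TangentSpace 𝓘(ℝ, E₂) p →L[ℝ] TangentSpace 𝓘(ℝ, E₂) p)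
    (hJ₁ : IsKaehler J₁) (hJ₂ : IsAlmostHermitian J₂)
    (F : M₁ → M₂) (hF : IsHolomorphicRiemannianMap J₁ J₂ F) :
    IsHarmonicMap E₁ E₂ F ↔ IsMinimalRange E₁ E₂ F := by
  have hR := hF.toIsRiemannianMap
  have mem : ∀ {p : M₁} {k : ℕ} {e : Fin k → TangentSpace 𝓘(ℝ, E₁) p},
      Submodule.span ℝ (Set.range e) = horizontalSpace E₁ E₂ F p →
      ∀ a, e a ∈ horizontalSpace E₁ E₂ F p :=
    fun h a ↦ h ▸ Submodule.subset_span (Set.mem_range_self a)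
  constructor
  · intro h p k e V he hspan hVr hV hVp
    rw [← h p, hF.tensionField_eq_sum hJ₁ hJ₂ p he hspan]
    exact Finset.sum_congr rfl fun a _ ↦ hR.starProjection_pullbackConnection (hV a) (hVr a)
      (mem hspan a) (mem hspan a) (hVp a)
  · intro h p
    obtain ⟨k, e, he, hspan⟩ :=
      Submodule.exists_orthonormal_span_eq (horizontalSpace E₁ E₂ F p)
    have hVr : ∀ a q, differential E₁ E₂ F q (coordField (e a) q) ∈ rangeDistribution E₁ E₂ F q :=
      fun a q ↦ differential_mem_rangeDistribution F q _
    have hV := fun a ↦ contMDiffAt_differential_coordField (E₂ := E₂) hF.smooth (e a)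
    have hVp : ∀ a, differential E₁ E₂ F p (coordField (e a) p) = differential E₁ E₂ F p (e a) :=
      fun a ↦ by rw [coordField_self]
    rw [hF.tensionField_eq_sum hJ₁ hJ₂ p he hspan,
      ← h p k e (fun a q ↦ differential E₁ E₂ F q (coordField (e a) q)) he hspan hVr hV hVp]
    exact Finset.sum_congr rfl fun a _ ↦ (hR.starProjection_pullbackConnection (hV a) (hVr a)
      (mem hspan a) (mem hspan a) (hVp a)).symm
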